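/- Let $U\subseteq\mathbb C$ be open and connected, and let $\mathcal A$ be the algebra of difference functions in one generator $u$ on the lattice $\mathbb Z^2$, i.e. the holomorphic functions of finitely many of the variables $u_N$ ($N\in\mathbb Z^2$, each ranging over $U$), with $u=u_{0}$, partial derivatives $\partial/\partial u_N$ and commuting shift automorphisms $\mathcal S_1,\mathcal S_2$, $\mathcal S_i u_N=u_{N+E_i}$ (with $E_1=(1,0)$, $E_2=(0,1)$); put $\mathcal S^N=\mathcal S_1^{N_1}\mathcal S_2^{N_2}$. A scalar difference operator $P=\sum_L P_L\mathcal S^L$ (finite sum, $P_L\in\mathcal A$; product $\mathcal S^L\circ a=\mathcal S^L(a)\,\mathcal S^L$) defines the multiplicative $\lambda$-bracket $$\{f_{\lambda}g\}=\sum_{M,N\in\mathbb Z^2}\frac{\partial g}{\partial u_N}(\lambda\mathcal S)^N P(\lambda\mathcal S)(\lambda\mathcal S)^{-M}\frac{\partial f}{\partial u_M}\in\mathcal A[\lambda_1^{\pm1},\lambda_2^{\pm1}],\qquad f,g\in\mathcal A .$$ Here $P(\lambda\mathcal S)=\sum_L P_L(\lambda\mathcal S)^L$. $P$ is called Hamiltonian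 if this bracket makes $\mathcal A$ a multiplicative Poisson vertex algebra, that is, if for all $f,g,h\in\mathcal A$ it is skewsymmetric, $\{g_\lambda f\}=-\sum_K(\lambda\mathcal S)^{-K}a_K$ where $\{f_\lambda g\}=\sum_K a_K\lambda^K$, and satisfies the Jacobi identity $\{f_\lambda\{g_\mu h\}\}-\{g_\mu\{f_\lambda h\}\}=\{\{f_\lambda g\}_{\lambda\mu}h\}$. Two Hamiltonian operators $P,Q$ are called compatible if $P+\eta Q$ is Hamiltonian for every $\eta\in\mathbb C$. An operator of one-dimensional form in the direction $i\in\{1,2\}$ is $$P_i[f,F,\alpha,\beta]=f\mathcal S_i\circ F^\alpha\mathcal S_i\circ f+f\big((F^\alpha+\beta)\mathcal S_i+\mathcal S_i\circ(F^\alpha+\beta)\big)\circ f-f\big((F^\alpha+\beta)\mathcal S_i^{-1}+\mathcal S_i^{-1}\circ(F^\alpha+\beta)\big)\circ f-f\mathcal S_i^{-1}\circ F^\alpha\mathcal S_i^{-1}\circ f ,$$ where $\alpha,\beta\in\mathbb C$, $f=f(u)$ is holomorphic on $U$, $F=F(u)$ is a non-constant holomorphic solution on $U$ of $fF'=F$,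 and $F^\alpha$ is any branch of the power that is holomorphic on $U$: it is holomorphic on $U$ and at every point where $F\neq0$ it equals $e^{\alpha w}$ for some logarithm $w$ of the value of $F$. Let $P=P_i[f_1,F_1,\alpha_1,\beta_1]$ and $Q=P_j[f_2,F_2,\alpha_2,\beta_2]$ be two such operators with $\alpha_1\neq0$ and $\alpha_2\neq0$. Then $P$ and $Q$ are (Hamiltonian and) compatible if and only if $i=j$ and there is a constant $\kappa\in\mathbb C$ with $f_2=\kappa f_1$ on $U$ and $\alpha_2=\kappa\alpha_1$. -/

import Mathlib

noncomputable section

namespace DiffAlg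

/-- Multi-indices `N ∈ ℤ^D`. -/
abbrev MultiIndex (D : ℕ) : Type := Fin D → ℤ

variable {D : ℕ} {U : Set ℂ}

/-- Lattice configurations `(u_N)_{N ∈ ℤ^D}` with values in the domain `U`. -/
abbrev Config (D : ℕ) (U : Set ℂ) : Type := MultiIndex D → U

/-- `φ` is a holomorphic function of finitely many of the variables `u_N`, each ranging over `U`. -/
def IsDifferenceFunction (φ : Config D U → ℂ) : Prop :=
  ∃ (s : Finset (MultiIndex D)) (g : (s → ℂ) → ℂ),
    AnalyticOnNhd ℂ g {y | ∀ n, y n ∈ U} ∧ ∀ x : Config D U, φ x = g (fun n => (x n : ℂ))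

/-- The presentation of a difference function may use any larger finite set of variables. -/
lemma IsDifferenceFunction.enlarge {φ : Config D U → ℂ} {s t : Finset (MultiIndex D)} (hst : s ⊆ t)
    {g : (s → ℂ) → ℂ} (hg : AnalyticOnNhd ℂ g {y | ∀ n, y n ∈ U})
    (hφ : ∀ x : Config D U, φ x = g (fun n => (x n : ℂ))) :
    ∃ g' : (t → ℂ) → ℂ, AnalyticOnNhd ℂ g' {y | ∀ n, y n ∈ U} ∧
      ∀ x : Config D U, φ x = g' (fun n => (x n : ℂ)) := by
  refine ⟨fun y => g (fun n => y ⟨n.1, hst n.2⟩), ?_, fun x => hφ x⟩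
  have hlin : AnalyticOnNhd ℂ (fun y : t → ℂ => fun n : s => y ⟨n.1, hst n.2⟩)
      {y | ∀ n, y n ∈ U} :=
    (ContinuousLinearMap.pi fun n : s =>
      (ContinuousLinearMap.proj (R := ℂ) (φ := fun _ : t => ℂ) ⟨n.1, hst n.2⟩)).analyticOnNhd _
  exact hg.comp hlin (fun y hy n => hy _)

lemma IsDifferenceFunction.common {φ ψ : Config D U → ℂ}
    (hφ : IsDifferenceFunction φ) (hψ : IsDifferenceFunction ψ) :
    ∃ (s : Finset (MultiIndex D)) (g h : (s → ℂ) → ℂ),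
      AnalyticOnNhd ℂ g {y | ∀ n, y n ∈ U} ∧ AnalyticOnNhd ℂ h {y | ∀ n, y n ∈ U} ∧
      (∀ x : Config D U, φ x = g (fun n => (x n : ℂ))) ∧
      ∀ x : Config D U, ψ x = h (fun n => (x n : ℂ)) := by
  obtain ⟨s, g, hg, hφ⟩ := hφ
  obtain ⟨t, h, hh, hψ⟩ := hψ
  obtain ⟨g', hg', hφ'⟩ :=
    IsDifferenceFunction.enlarge (Finset.subset_union_left (s₂ := t)) hg hφ
  obtain ⟨h', hh', hψ'⟩ :=
    IsDifferenceFunction.enlarge (Finset.subset_union_right (s₁ := s)) hh hψ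
  exact ⟨s ∪ t, g', h', hg', hh', hφ', hψ'⟩

/-- The algebra `𝒜` of difference functions in one generator `u` on the lattice `ℤ^D`. -/
def DiffFun (D : ℕ) (U : Set ℂ) : Subalgebra ℂ (Config D U → ℂ) where
  carrier := {φ | IsDifferenceFunction φ}
  mul_mem' := by
    intro φ ψ hφ hψ
    obtain ⟨s, g, h, hg, hh, h₁, h₂⟩ := hφ.common hψ
    exact ⟨s, g * h, hg.mul hh, fun x => by simp [h₁ x, h₂ x]⟩
  add_mem' := by
    intro φ ψ hφ hψ
    obtain ⟨s, g, h, hg, hh, h₁, h₂⟩ := hφ.common hψ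
    exact ⟨s, g + h, hg.add hh, fun x => by simp [h₁ x, h₂ x]⟩
  algebraMap_mem' := by
    intro c
    exact ⟨∅, fun _ => c, analyticOnNhd_const, fun x => by simp⟩

/-- The shift `𝒮^K` on functions of a configuration, characterised by `𝒮^K u_N = u_{N+K}`. -/
def shiftFun (K : MultiIndex D) (φ : Config D U → ℂ) : Config D U → ℂ :=
  fun x => φ (fun N => x (N + K))

lemma shiftFun_mem (K : MultiIndex D) {φ : Config D U → ℂ} (hφ : φ ∈ DiffFun D U) :
    shiftFun K φ ∈ DiffFun D U := by
  obtain ⟨s, g, hg, h⟩ := hφ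
  classical
  let t : Finset (MultiIndex D) := s.image (· + K)
  have ht : ∀ n : s, n.1 + K ∈ t := fun n => Finset.mem_image_of_mem _ n.2
  refine ⟨t, fun y => g (fun n => y ⟨n.1 + K, ht n⟩), ?_, fun x => by simp [shiftFun, h]⟩
  have hlin : AnalyticOnNhd ℂ (fun y : t → ℂ => fun n : s => y ⟨n.1 + K, ht n⟩)
      {y | ∀ n, y n ∈ U} :=
    (ContinuousLinearMap.pi fun n : s =>
      (ContinuousLinearMap.proj (R := ℂ) (φ := fun _ : t => ℂ) ⟨n.1 + K, ht n⟩)).analyticOnNhd _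
  exact hg.comp hlin (fun y hy n => hy _)

/-- The action of `ℤ^D` on `𝒜` by the shift automorphisms `𝒮^K = 𝒮_1^{K_1} ⋯ 𝒮_D^{K_D}`. -/
instance shiftAction : MulSemiringAction (Multiplicative (MultiIndex D)) (DiffFun D U) where
  smul K φ := ⟨shiftFun K.toAdd φ.1, shiftFun_mem _ φ.2⟩
  one_smul φ := Subtype.ext (funext fun x => congrArg φ.1 (funext fun N => congrArg x (add_zero N)))
  mul_smul K L φ := Subtype.ext (funext fun x => congrArg φ.1 (funext fun N =>
    congrArg x (by
      change N + (K.toAdd + L.toAdd) = N + L.toAdd + K.toAdd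
      abel)))
  smul_zero _ := rfl
  smul_add _ _ _ := rfl
  smul_one _ := rfl
  smul_mul _ _ _ := rfl

open scoped Classical in
/-- The partial derivative `∂φ/∂u_N` of a function of a configuration. -/
def partialFun (N : MultiIndex D) (φ : Config D U → ℂ) : Config D U → ℂ :=
  fun x =>
    deriv (fun t : ℂ => if h : t ∈ U then φ (Function.update x N ⟨t, h⟩) else 0) (x N)

lemma partialFun_mem (hU : IsOpen U) (N : MultiIndex D) {φ : Config D U → ℂ}
    (hφ : φ ∈ DiffFun D U) : partialFun N φ ∈ DiffFun D U := by
  classical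
  obtain ⟨s, g, hg, h⟩ := hφ
  obtain ⟨g, hg, h⟩ := IsDifferenceFunction.enlarge (Finset.subset_insert N s) hg h
  let t : Finset (MultiIndex D) := insert N s
  let i : t := ⟨N, Finset.mem_insert_self N s⟩
  let v : t → ℂ := Pi.single i 1
  refine ⟨t, fun y => fderiv ℂ g y v, ?_, fun x => ?_⟩
  · exact ((ContinuousLinearMap.apply ℂ ℂ v).analyticOnNhd Set.univ).comp hg.fderiv
      (fun _ _ => Set.mem_univ _)
  · let y : t → ℂ := fun n => (x n : ℂ)
    have hev : (fun t : ℂ => if h : t ∈ U then φ (Function.update x N ⟨t, h⟩) else 0)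
        =ᶠ[nhds (x N : ℂ)] fun t => g (Function.update y i t) := by
      filter_upwards [hU.mem_nhds (x N).2] with z hz
      simp only [hz, dif_pos, h]
      congr 1
      funext n
      by_cases hn : n = i
      · subst hn
        simp [i]
      · have hn' : (n : MultiIndex D) ≠ N := fun e => hn (Subtype.ext e)
        simp [hn, hn', y]
    have hy : Function.update y i (x N : ℂ) = y := Function.update_eq_self i y
    have hd : HasDerivAt (fun t => g (Function.update y i t)) (fderiv ℂ g y v) (x N : ℂ) := by
      have h1 : HasFDerivAt g (fderiv ℂ g y) (Function.update y i (x N : ℂ)) := by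
        rw [hy]
        exact (hg y (fun n => (x n).2)).differentiableAt.hasFDerivAt
      exact h1.comp_hasDerivAt _ (hasDerivAt_update y i (x N : ℂ))
    exact hev.deriv_eq.trans hd.deriv

/-- The partial derivative `∂/∂u_N : 𝒜 → 𝒜`. -/
def partialD (hU : IsOpen U) (N : MultiIndex D) (φ : DiffFun D U) : DiffFun D U :=
  ⟨partialFun N φ.1, partialFun_mem hU N φ.2⟩

/-- A function `f(u)` of the single variable `u = u_0`, as an element of `𝒜`. -/
def ofFun (D : ℕ) {f : ℂ → ℂ} (hf : AnalyticOnNhd ℂ f U) : DiffFun D U :=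
  ⟨fun x => f (x 0), {0}, fun y => f (y ⟨0, Finset.mem_singleton_self 0⟩),
    hf.comp ((ContinuousLinearMap.proj (R := ℂ)
      (φ := fun _ : ({0} : Finset (MultiIndex D)) => ℂ)
      ⟨0, Finset.mem_singleton_self 0⟩).analyticOnNhd _) (fun _ hy => hy _),
    fun _ => rfl⟩

/-- Scalar local difference operators `∑_L P_L 𝒮^L`, `P_L ∈ 𝒜`, with the product `∘` determined by
`𝒮^L ∘ a = 𝒮^L(a) 𝒮^L`. -/
abbrev DiffOp (D : ℕ) (U : Set ℂ) : Type :=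
  SkewMonoidAlgebra (DiffFun D U) (Multiplicative (MultiIndex D))

/-- Multiplication by `a ∈ 𝒜` as a difference operator. -/
def mulOp (a : DiffFun D U) : DiffOp D U := SkewMonoidAlgebra.single 1 a

/-- The difference operator `𝒮^K`. -/
def shiftOp (K : MultiIndex D) : DiffOp D U :=
  SkewMonoidAlgebra.single (Multiplicative.ofAdd K) 1

/-- The coefficient `P_L` of `𝒮^L` in `P`. -/
def opCoeff (P : DiffOp D U) (L : MultiIndex D) : DiffFun D U :=
  SkewMonoidAlgebra.coeff P (Multiplicative.ofAdd L)

/-- The operator `∑_{M,N} (∂g/∂u_N) 𝒮^N ∘ P ∘ 𝒮^{-M} ∘ (∂f/∂u_M)`; the sum is finite since `f` and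
`g` depend on finitely many variables. -/
def bracketOp (hU : IsOpen U) (P : DiffOp D U) (f g : DiffFun D U) : DiffOp D U :=
  ∑ᶠ (N : MultiIndex D), ∑ᶠ (M : MultiIndex D),
    mulOp (partialD hU N g) * shiftOp N * P * shiftOp (-M) * mulOp (partialD hU M f)

/-- The `λ`-bracket `{f_λ g} = ∑_{M,N} (∂g/∂u_N) (λ𝒮)^N P(λ𝒮) (λ𝒮)^{-M} (∂f/∂u_M)` associated with
`P`: `lambdaBracket hU P f g K ∈ 𝒜` is the coefficient of `λ^K`. Since every `𝒮^K` comes with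
`λ^K`, it is the coefficient of `𝒮^K` in the corresponding composition of operators. -/
def lambdaBracket (hU : IsOpen U) (P : DiffOp D U) (f g : DiffFun D U) (K : MultiIndex D) :
    DiffFun D U :=
  opCoeff (bracketOp hU P f g) K

/-- Skewsymmetry `{g_λ f} = - _→{f_{(λ𝒮)^{-1}} g}`, read off on the coefficient of `λ^K`. -/
def IsSkewsymmetric (hU : IsOpen U) (P : DiffOp D U) : Prop :=
  ∀ (f g : DiffFun D U) (K : MultiIndex D),
    lambdaBracket hU P g f K = -(Multiplicative.ofAdd K • lambdaBracket hU P f g (-K))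

/-- The Jacobi identity `{f_λ {g_μ h}} - {g_μ {f_λ h}} = {{f_λ g}_{λμ} h}`, read off on the
coefficient of `λ^K μ^R`; on the right-hand side the term `λ^Q (λμ)^R` contributes to it exactly
when `Q = K - R`. -/
def SatisfiesJacobi (hU : IsOpen U) (P : DiffOp D U) : Prop :=
  ∀ (f g h : DiffFun D U) (K R : MultiIndex D),
    lambdaBracket hU P f (lambdaBracket hU P g h R) K
      - lambdaBracket hU P g (lambdaBracket hU P f h K) R
      = lambdaBracket hU P (lambdaBracket hU P f g (K - R)) h R

/-- `P` is Hamiltonian: its `λ`-bracket makes `𝒜` a multiplicative Poisson vertex algebra. -/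
def IsHamiltonian (hU : IsOpen U) (P : DiffOp D U) : Prop :=
  IsSkewsymmetric hU P ∧ SatisfiesJacobi hU P

/-- `P` and `Q` are Hamiltonian operators all of whose combinations `P + η Q` are Hamiltonian. -/
def AreCompatible (hU : IsOpen U) (P Q : DiffOp D U) : Prop :=
  IsHamiltonian hU P ∧ IsHamiltonian hU Q ∧ ∀ η : ℂ, IsHamiltonian hU (P + η • Q)

/-- `G` is a (holomorphic, single-valued) branch of the power `F^α` on `U`: at every point where
`F ≠ 0`, the value of `G` is `exp (α w)` for some logarithm `w` of the value of `F`. -/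
def IsPowerBranch (U : Set ℂ) (F : ℂ → ℂ) (α : ℂ) (G : ℂ → ℂ) : Prop :=
  AnalyticOnNhd ℂ G U ∧
    ∀ z ∈ U, F z ≠ 0 → ∃ w : ℂ, Complex.exp w = F z ∧ G z = Complex.exp (α * w)

/-- The data `(f, F, α, β)` of an operator of one-dimensional form, with a chosen branch of
`F^α`: `f` and `F` are holomorphic on `U`, and `F` is a non-constant solution of `f F' = F`. -/
structure OneDimData (U : Set ℂ) where
  f : ℂ → ℂ
  F : ℂ → ℂ
  α : ℂ
  β : ℂ
  Fpow : ℂ → ℂ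
  analytic_f : AnalyticOnNhd ℂ f U
  analytic_F : AnalyticOnNhd ℂ F U
  nonconstant_F : ¬ ∃ c : ℂ, ∀ z ∈ U, F z = c
  ode : ∀ z ∈ U, f z * deriv F z = F z
  isPower : IsPowerBranch U F α Fpow

/-- The operator, with shifts in the direction `i`,
`f 𝒮_i ∘ F^α 𝒮_i ∘ f + f ((F^α + β) 𝒮_i + 𝒮_i ∘ (F^α + β)) ∘ f`
`  - f ((F^α + β) 𝒮_i⁻¹ + 𝒮_i⁻¹ ∘ (F^α + β)) ∘ f - f 𝒮_i⁻¹ ∘ F^α 𝒮_i⁻¹ ∘ f`. -/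
def OneDimData.op (d : OneDimData U) (i : Fin D) : DiffOp D U :=
  let f : DiffOp D U := mulOp (ofFun D d.analytic_f)
  let G : DiffOp D U := mulOp (ofFun D d.isPower.1)
  let H : DiffOp D U := mulOp (ofFun D d.isPower.1 + algebraMap ℂ (DiffFun D U) d.β)
  let S : DiffOp D U := shiftOp (Pi.single i 1)
  let T : DiffOp D U := shiftOp (-Pi.single i 1)
  f * S * G * S * f + f * (H * S + S * H) * f - f * (H * T + T * H) * f - f * T * G * T * f

end DiffAlg

end

/-! The coefficient of $\lambda^K$ in $\{f_\lambda g\}$ is the ordinary bracket $[\mathcal S^K f,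
g]$, where $[\cdot,\cdot]$ is the biderivation of $\mathcal A$ determined by the shift-invariant
matrix of brackets $[u_M,u_N]$ (`lambdaBracket_eq_br`). Hence $P$ is Hamiltonian exactly when this
is a Lie bracket, which can be tested on the generators (`isHamiltonian_iff`,
`isLieBracket_br_iff`).

Write $G=F^\alpha$. For an operator of one-dimensional form the matrix is $f(u_N)f(u_M)$ times
`lineKernel`, which is affine in the values of $G$ and links sites at distance 1 or 2 on a line. The
equation $fG'=\alpha G$ reduces the Jacobi identity to a polynomial identity for `lineKernel`. If
$f_2=\kappa f_1$ and $\alpha_2=\kappa\alpha_1$, then $P+\eta Q$ has the same form, with $f=f_1$ and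
$G=G_1+\eta\kappa^2G_2$, which still solves $f_1G'=\alpha_1G$; this gives sufficiency.

For necessity, compatibility makes the mixed part of the Jacobi identity vanish, and three triples
of sites suffice. The triple $(2E_i,0,E_j)$ excludes $i\ne j$, because $G_2$ is not constant. The
triple $(0,2E,4E)$ produces the Wronskian of $f_1,f_2$ times a factor whose vanishing also says that
they are proportional. The triple $(0,2E,3E)$ then relates the exponents. -/

noncomputable section

namespace DiffAlg

variable {D : ℕ} {U : Set ℂ}

/-! ### Partial derivatives, shifts and vector fields on difference functions -/

section Calculus

open scoped Classical in
/-- The restriction of `φ` to the line through `x` in the direction of the variable `u_N`. -/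
def lineFun (φ : Config D U → ℂ) (x : Config D U) (N : MultiIndex D) (t : ℂ) : ℂ :=
  if h : t ∈ U then φ (Function.update x N ⟨t, h⟩) else 0

lemma lineFun_apply_self (φ : Config D U → ℂ) (x : Config D U) (N : MultiIndex D) :
    lineFun φ x N (x N) = φ x := by
  simp [lineFun]

lemma hasDerivAt_lineFun_of_presentation (hU : IsOpen U) {φ : Config D U → ℂ}
    {s : Finset (MultiIndex D)} {g : (s → ℂ) → ℂ} (hg : AnalyticOnNhd ℂ g {y | ∀ n, y n ∈ U})
    (h : ∀ x : Config D U, φ x = g (fun n => (x n : ℂ))) (i : s) (x : Config D U) :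
    HasDerivAt (lineFun φ x i) (fderiv ℂ g (fun n => (x n : ℂ)) (Pi.single i 1)) (x i) := by
  classical
  let y : s → ℂ := fun n => (x n : ℂ)
  have hev : lineFun φ x i =ᶠ[nhds (x i : ℂ)] fun t => g (Function.update y i t) := by
    filter_upwards [hU.mem_nhds (x i).2] with z hz
    simp only [lineFun, hz, dif_pos, h]
    congr 1
    funext n
    by_cases hn : n = i
    · subst hn
      simp
    · have hn' : (n : MultiIndex D) ≠ i := fun e => hn (Subtype.ext e)
      simp [hn, hn', y]
  have hy : Function.update y i (x i : ℂ) = y := Function.update_eq_self i y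
  have hd : HasDerivAt (fun t => g (Function.update y i t)) (fderiv ℂ g y (Pi.single i 1))
      (x i : ℂ) := by
    have h1 : HasFDerivAt g (fderiv ℂ g y) (Function.update y i (x i : ℂ)) := by
      rw [hy]
      exact (hg y (fun n => (x n).2)).differentiableAt.hasFDerivAt
    exact h1.comp_hasDerivAt _ (hasDerivAt_update y i (x i : ℂ))
  exact hd.congr_of_eventuallyEq hev

lemma partialFun_of_presentation (hU : IsOpen U) {φ : Config D U → ℂ}
    {s : Finset (MultiIndex D)} {g : (s → ℂ) → ℂ} (hg : AnalyticOnNhd ℂ g {y | ∀ n, y n ∈ U})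
    (h : ∀ x : Config D U, φ x = g (fun n => (x n : ℂ))) (i : s) (x : Config D U) :
    partialFun i φ x = fderiv ℂ g (fun n => (x n : ℂ)) (Pi.single i 1) :=
  (hasDerivAt_lineFun_of_presentation hU hg h i x).deriv

lemma hasDerivAt_lineFun (hU : IsOpen U) (N : MultiIndex D) (φ : DiffFun D U) (x : Config D U) :
    HasDerivAt (lineFun φ.1 x N) ((partialD hU N φ).1 x) (x N) := by
  classical
  obtain ⟨s, g, hg, h⟩ := φ.2
  obtain ⟨g, hg, h⟩ := IsDifferenceFunction.enlarge (Finset.subset_insert N s) hg h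
  exact (hasDerivAt_lineFun_of_presentation hU hg h
    ⟨N, Finset.mem_insert_self N s⟩ x).differentiableAt.hasDerivAt

lemma partialD_eq_of_hasDerivAt (hU : IsOpen U) {N : MultiIndex D} {φ : DiffFun D U}
    {x : Config D U} {c : ℂ} {l : ℂ → ℂ} (h : HasDerivAt l c (x N))
    (hl : ∀ (t : ℂ) (ht : t ∈ U), φ.1 (Function.update x N ⟨t, ht⟩) = l t) :
    (partialD hU N φ).1 x = c := by
  refine (h.congr_of_eventuallyEq ?_).deriv
  filter_upwards [hU.mem_nhds (x N).2] with t ht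
  simp [ht, hl]

variable (hU : IsOpen U) (N : MultiIndex D)

lemma partialD_add (φ ψ : DiffFun D U) :
    partialD hU N (φ + ψ) = partialD hU N φ + partialD hU N ψ := by
  refine Subtype.ext (funext fun x => ?_)
  refine partialD_eq_of_hasDerivAt hU
    ((hasDerivAt_lineFun hU N φ x).add (hasDerivAt_lineFun hU N ψ x)) fun t ht => ?_
  simp [lineFun, ht]

lemma partialD_mul (φ ψ : DiffFun D U) :
    partialD hU N (φ * ψ) = partialD hU N φ * ψ + φ * partialD hU N ψ := by
  refine Subtype.ext (funext fun x => ?_)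
  have := (hasDerivAt_lineFun hU N φ x).mul (hasDerivAt_lineFun hU N ψ x)
  simp only [lineFun_apply_self] at this
  refine partialD_eq_of_hasDerivAt hU this fun t ht => ?_
  simp [lineFun, ht]

lemma partialD_algebraMap (c : ℂ) : partialD hU N (algebraMap ℂ (DiffFun D U) c) = 0 := by
  refine Subtype.ext (funext fun x => ?_)
  exact partialD_eq_of_hasDerivAt hU (hasDerivAt_const _ c) fun t ht => rfl

/-- The partial derivative `∂/∂u_N` as an additive map. -/
def partialHom : DiffFun D U →+ DiffFun D U :=
  AddMonoidHom.mk' (partialD hU N) (partialD_add hU N)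

lemma partialD_zero : partialD hU N (0 : DiffFun D U) = 0 := (partialHom hU N).map_zero

/-- In a presentation whose variables include both $u_M$ and $u_N$, each side is a value of the
second Fréchet derivative, which is symmetric for analytic functions. -/
lemma partialD_comm (M N : MultiIndex D) (φ : DiffFun D U) :
    partialD hU M (partialD hU N φ) = partialD hU N (partialD hU M φ) := by
  classical
  obtain ⟨s, g, hg, h⟩ := φ.2
  have hst : s ⊆ insert M (insert N s) := fun a ha => by simp [ha]
  obtain ⟨g, hg, h⟩ := IsDifferenceFunction.enlarge hst hg h
  generalize ht : insert M (insert N s) = t at *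
  obtain ⟨i, rfl⟩ : ∃ i : t, (i : MultiIndex D) = M := ⟨⟨M, by simp [← ht]⟩, rfl⟩
  obtain ⟨j, rfl⟩ : ∃ j : t, (j : MultiIndex D) = N := ⟨⟨N, by simp [← ht]⟩, rfl⟩
  have hg' : ∀ v : t → ℂ, AnalyticOnNhd ℂ (fun y => fderiv ℂ g y v) {y | ∀ n, y n ∈ U} := fun v =>
    ((ContinuousLinearMap.apply ℂ ℂ v).analyticOnNhd Set.univ).comp hg.fderiv
      (fun _ _ => Set.mem_univ _)
  have key : ∀ (i j : t) (x : Config D U), (partialD hU i (partialD hU j φ)).1 x =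
      fderiv ℂ (fderiv ℂ g) (fun n => (x n : ℂ)) (Pi.single i 1) (Pi.single j 1) := by
    intro i j x
    refine (partialFun_of_presentation hU (hg' (Pi.single j 1))
      (fun x => partialFun_of_presentation hU hg h j x) i x).trans ?_
    have hd : DifferentiableAt ℂ (fderiv ℂ g) (fun n : t => (x n : ℂ)) :=
      (hg.fderiv _ fun n => (x n).2).differentiableAt
    rw [fderiv_clm_apply hd (differentiableAt_const _)]
    simp
  refine Subtype.ext (funext fun x => ?_)
  rw [key, key]
  exact ((hg _ fun n => (x n).2).contDiffAt (n := ⊤)).isSymmSndFDerivAt_of_omega _ _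

lemma exists_finset_partialD_eq_zero (φ : DiffFun D U) :
    ∃ s : Finset (MultiIndex D), ∀ N ∉ s, partialD hU N φ = 0 := by
  obtain ⟨s, g, hg, h⟩ := φ.2
  refine ⟨s, fun N hN => Subtype.ext (funext fun x => ?_)⟩
  refine partialD_eq_of_hasDerivAt hU (hasDerivAt_const _ (φ.1 x)) fun t ht => ?_
  rw [h, h]
  congr 1
  funext n
  rw [Function.update_of_ne]
  rintro rfl
  exact hN n.2

/-- The shift `𝒮^K : 𝒜 → 𝒜`. -/
def shift (K : MultiIndex D) : DiffFun D U →+* DiffFun D U :=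
  MulSemiringAction.toRingHom _ _ (Multiplicative.ofAdd K)

lemma smul_eq_shift (K : Multiplicative (MultiIndex D)) (φ : DiffFun D U) :
    K • φ = shift K.toAdd φ := rfl

lemma shift_apply (K : MultiIndex D) (φ : DiffFun D U) (x : Config D U) :
    (shift K φ).1 x = φ.1 fun N => x (N + K) := rfl

lemma shift_shift (K L : MultiIndex D) (φ : DiffFun D U) :
    shift K (shift L φ) = shift (K + L) φ :=
  (mul_smul (Multiplicative.ofAdd K) (Multiplicative.ofAdd L) φ).symm

lemma shift_zero (φ : DiffFun D U) : shift 0 φ = φ :=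
  one_smul (Multiplicative (MultiIndex D)) φ

lemma partialD_shift (K N : MultiIndex D) (φ : DiffFun D U) :
    partialD hU (N + K) (shift K φ) = shift K (partialD hU N φ) := by
  refine Subtype.ext (funext fun x => ?_)
  refine partialD_eq_of_hasDerivAt hU (hasDerivAt_lineFun hU N φ fun L => x (L + K)) fun t ht => ?_
  simp only [lineFun, ht, dif_pos, shift_apply]
  refine congrArg φ.1 (funext fun L => ?_)
  simp [Function.update_apply]

lemma partialD_shift' (K N : MultiIndex D) (φ : DiffFun D U) :
    partialD hU N (shift K φ) = shift K (partialD hU (N - K) φ) := by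
  rw [← partialD_shift, sub_add_cancel]

lemma shift_algebraMap (K : MultiIndex D) (c : ℂ) :
    shift K (algebraMap ℂ (DiffFun D U) c) = algebraMap ℂ (DiffFun D U) c := rfl

/-- The function `f(u_N)` of the single variable `u_N`, as an element of `𝒜`. -/
def site {f : ℂ → ℂ} (hf : AnalyticOnNhd ℂ f U) (N : MultiIndex D) : DiffFun D U :=
  shift N (ofFun D hf)

lemma site_apply {f : ℂ → ℂ} (hf : AnalyticOnNhd ℂ f U) (N : MultiIndex D) (x : Config D U) :
    (site hf N).1 x = f (x N) := by
  change f (x (0 + N)) = _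
  rw [zero_add]

lemma shift_site {f : ℂ → ℂ} (hf : AnalyticOnNhd ℂ f U) (K N : MultiIndex D) :
    shift K (site hf N) = site hf (K + N) := shift_shift _ _ _

lemma partialD_site_self {f : ℂ → ℂ} (hf : AnalyticOnNhd ℂ f U) (N : MultiIndex D) :
    partialD hU N (site hf N) = site hf.deriv N := by
  refine Subtype.ext (funext fun x => ?_)
  rw [site_apply]
  refine partialD_eq_of_hasDerivAt hU (hf _ (x N).2).differentiableAt.hasDerivAt fun t ht => ?_
  simp [site_apply]

lemma partialD_site_of_ne {f : ℂ → ℂ} (hf : AnalyticOnNhd ℂ f U) {M N : MultiIndex D}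
    (h : M ≠ N) : partialD hU M (site hf N) = 0 := by
  refine Subtype.ext (funext fun x => ?_)
  refine partialD_eq_of_hasDerivAt hU (hasDerivAt_const _ (f (x N))) fun t ht => ?_
  rw [site_apply, Function.update_of_ne h.symm]

/-- The generator `u_N`. -/
def gen (U : Set ℂ) (N : MultiIndex D) : DiffFun D U := site (analyticOnNhd_id (s := U)) N

/-- The vector field `∑_N c_N ∂/∂u_N`. -/
def vf (c : MultiIndex D → DiffFun D U) (ψ : DiffFun D U) : DiffFun D U :=
  ∑ᶠ N, partialD hU N ψ * c N

lemma vf_eq_sum (c : MultiIndex D → DiffFun D U) {ψ : DiffFun D U} {s : Finset (MultiIndex D)}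
    (hs : ∀ N ∉ s, partialD hU N ψ = 0) : vf hU c ψ = ∑ N ∈ s, partialD hU N ψ * c N := by
  refine finsum_eq_sum_of_support_subset _ fun N hN => ?_
  by_contra h
  exact hN (by simp only [hs N h, zero_mul])

lemma exists_finset_partialD_eq_zero₂ (φ ψ : DiffFun D U) :
    ∃ s : Finset (MultiIndex D), (∀ N ∉ s, partialD hU N φ = 0) ∧
      ∀ N ∉ s, partialD hU N ψ = 0 := by
  classical
  obtain ⟨s, hs⟩ := exists_finset_partialD_eq_zero hU φ
  obtain ⟨t, ht⟩ := exists_finset_partialD_eq_zero hU ψ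
  exact ⟨s ∪ t, fun N hN => hs N fun h => hN (by simp [h]),
    fun N hN => ht N fun h => hN (by simp [h])⟩

variable (c d : MultiIndex D → DiffFun D U)

lemma vf_add (φ ψ : DiffFun D U) : vf hU c (φ + ψ) = vf hU c φ + vf hU c ψ := by
  obtain ⟨s, h₁, h₂⟩ := exists_finset_partialD_eq_zero₂ hU φ ψ
  rw [vf_eq_sum hU c h₁, vf_eq_sum hU c h₂, vf_eq_sum hU c (s := s), ← Finset.sum_add_distrib]
  · exact Finset.sum_congr rfl fun N _ => by rw [partialD_add, add_mul]
  · exact fun N hN => by rw [partialD_add, h₁ N hN, h₂ N hN, add_zero]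

lemma vf_mul (φ ψ : DiffFun D U) : vf hU c (φ * ψ) = vf hU c φ * ψ + φ * vf hU c ψ := by
  obtain ⟨s, h₁, h₂⟩ := exists_finset_partialD_eq_zero₂ hU φ ψ
  rw [vf_eq_sum hU c h₁, vf_eq_sum hU c h₂, vf_eq_sum hU c (s := s), Finset.sum_mul,
    Finset.mul_sum, ← Finset.sum_add_distrib]
  · exact Finset.sum_congr rfl fun N _ => by rw [partialD_mul]; ring
  · exact fun N hN => by rw [partialD_mul, h₁ N hN, h₂ N hN, zero_mul, mul_zero, add_zero]

lemma vf_algebraMap (a : ℂ) : vf hU c (algebraMap ℂ (DiffFun D U) a) = 0 := by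
  rw [vf_eq_sum hU c (s := ∅) fun N _ => partialD_algebraMap hU N a, Finset.sum_empty]

/-- The vector field `∑_N c_N ∂/∂u_N` as an additive map. -/
def vfHom : DiffFun D U →+ DiffFun D U := AddMonoidHom.mk' (vf hU c) (vf_add hU c)

lemma vf_zero : vf hU c 0 = 0 := (vfHom hU c).map_zero

lemma vf_neg (φ : DiffFun D U) : vf hU c (-φ) = -vf hU c φ := (vfHom hU c).map_neg φ

lemma vf_sum {ι : Type*} (s : Finset ι) (φ : ι → DiffFun D U) :
    vf hU c (∑ i ∈ s, φ i) = ∑ i ∈ s, vf hU c (φ i) :=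
  map_sum (vfHom hU c) φ s

lemma vf_site {f : ℂ → ℂ} (hf : AnalyticOnNhd ℂ f U) (N : MultiIndex D) :
    vf hU c (site hf N) = site hf.deriv N * c N := by
  rw [vf_eq_sum hU c (s := {N}), Finset.sum_singleton, partialD_site_self]
  exact fun M hM => partialD_site_of_ne hU hf (by simpa using hM)

lemma site_deriv_id (N : MultiIndex D) :
    site (analyticOnNhd_id (s := U)).deriv N = (1 : DiffFun D U) := by
  refine Subtype.ext (funext fun x => ?_)
  rw [site_apply]
  simp

lemma vf_gen (N : MultiIndex D) : vf hU c (gen U N) = c N := by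
  rw [gen, vf_site, site_deriv_id, one_mul]

lemma vf_add_left (ψ : DiffFun D U) :
    vf hU (fun N => c N + d N) ψ = vf hU c ψ + vf hU d ψ := by
  obtain ⟨s, h⟩ := exists_finset_partialD_eq_zero hU ψ
  simp only [vf_eq_sum hU _ h, mul_add, Finset.sum_add_distrib]

lemma vf_sub_left (ψ : DiffFun D U) :
    vf hU (fun N => c N - d N) ψ = vf hU c ψ - vf hU d ψ := by
  obtain ⟨s, h⟩ := exists_finset_partialD_eq_zero hU ψ
  simp only [vf_eq_sum hU _ h, mul_sub, Finset.sum_sub_distrib]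

lemma vf_zero_left (ψ : DiffFun D U) : vf hU (fun _ => 0) ψ = 0 := by
  simp only [vf, mul_zero, finsum_zero]

/-- The second-order terms cancel because partial derivatives commute, so a commutator of vector
fields is again a vector field. -/
lemma vf_commutator (ψ : DiffFun D U) :
    vf hU c (vf hU d ψ) - vf hU d (vf hU c ψ) =
      vf hU (fun N => vf hU c (d N) - vf hU d (c N)) ψ := by
  obtain ⟨s, h⟩ := exists_finset_partialD_eq_zero hU ψ
  have h' : ∀ M, ∀ N ∉ s, partialD hU N (partialD hU M ψ) = 0 := fun M N hN => by
    rw [partialD_comm, h N hN, partialD_zero]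
  have key : ∀ c d : MultiIndex D → DiffFun D U, vf hU c (vf hU d ψ) =
      ∑ M ∈ s, ∑ N ∈ s, partialD hU N (partialD hU M ψ) * c N * d M
        + ∑ M ∈ s, partialD hU M ψ * vf hU c (d M) := by
    intro c d
    rw [vf_eq_sum hU d h, vf_sum, ← Finset.sum_add_distrib]
    refine Finset.sum_congr rfl fun M _ => ?_
    rw [vf_mul, vf_eq_sum hU c (h' M), Finset.sum_mul]
  rw [key, key, vf_eq_sum hU _ h, Finset.sum_comm]
  simp only [mul_sub, Finset.sum_sub_distrib]
  rw [add_sub_add_comm, sub_eq_zero.2, zero_add]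
  refine Finset.sum_congr rfl fun M _ => Finset.sum_congr rfl fun N _ => ?_
  rw [partialD_comm]
  ring

lemma shift_vf (K : MultiIndex D) (ψ : DiffFun D U) :
    shift K (vf hU c ψ) = vf hU (fun N => shift K (c (N - K))) (shift K ψ) := by
  obtain ⟨s, h⟩ := exists_finset_partialD_eq_zero hU ψ
  classical
  rw [vf_eq_sum hU c h, vf_eq_sum hU _ (s := s.map (addRightEmbedding K)), Finset.sum_map, map_sum]
  · simp [partialD_shift]
  · intro N hN
    rw [partialD_shift', h, map_zero]
    intro hN'
    exact hN (by simpa using ⟨_, hN', sub_add_cancel N K⟩)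

end Calculus

/-! ### From the λ-bracket to a Lie bracket on generators -/

section Bracket

lemma opCoeff_add (P Q : DiffOp D U) (L : MultiIndex D) :
    opCoeff (P + Q) L = opCoeff P L + opCoeff Q L := by
  simp [opCoeff]

lemma opCoeff_single (K L : MultiIndex D) (a : DiffFun D U) :
    opCoeff (SkewMonoidAlgebra.single (Multiplicative.ofAdd K) a) L = if K = L then a else 0 := by
  classical
  rw [opCoeff, SkewMonoidAlgebra.coeff_single_apply]
  simp

lemma opCoeff_sum {ι : Type*} (s : Finset ι) (P : ι → DiffOp D U) (L : MultiIndex D) :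
    opCoeff (∑ i ∈ s, P i) L = ∑ i ∈ s, opCoeff (P i) L :=
  map_sum (AddMonoidHom.mk' (fun P : DiffOp D U => opCoeff P L) fun P Q => opCoeff_add P Q L) P s

lemma single_mul_single' (K L : MultiIndex D) (a b : DiffFun D U) :
    (SkewMonoidAlgebra.single (Multiplicative.ofAdd K) a : DiffOp D U) *
      SkewMonoidAlgebra.single (Multiplicative.ofAdd L) b =
      SkewMonoidAlgebra.single (Multiplicative.ofAdd (K + L)) (a * shift K b) := by
  rw [SkewMonoidAlgebra.single_mul_single]
  rfl

lemma mulOp_eq (a : DiffFun D U) :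
    mulOp a = SkewMonoidAlgebra.single (Multiplicative.ofAdd (0 : MultiIndex D)) a := rfl

lemma mulOp_zero : mulOp (0 : DiffFun D U) = 0 := SkewMonoidAlgebra.single_zero _

lemma opCoeff_sandwich (P : DiffOp D U) (a b : DiffFun D U) (N M K : MultiIndex D) :
    opCoeff (mulOp a * shiftOp N * P * shiftOp (-M) * mulOp b) K =
      a * shift N (opCoeff P (K - N + M)) * shift K b := by
  induction P using SkewMonoidAlgebra.induction_on with
  | zero => simp [opCoeff]
  | add P Q hP hQ =>
    simp only [mul_add, add_mul, opCoeff_add, hP, hQ, map_add]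
  | single L p =>
    induction L with | _ L =>
    simp only [mulOp_eq, shiftOp, single_mul_single', opCoeff_single, mul_one,
      map_one, zero_add, add_zero, ← sub_eq_add_neg]
    by_cases h : N + L - M = K
    · subst h
      rw [if_pos rfl, if_pos (by abel)]
    · rw [if_neg h, if_neg, map_zero, mul_zero, zero_mul]
      rintro rfl
      exact h (by abel)

variable (hU : IsOpen U)

/-- The biderivation with `[u_M, u_N] = J_{N,M}`. -/
def br (J : MultiIndex D → MultiIndex D → DiffFun D U) (φ ψ : DiffFun D U) : DiffFun D U :=
  vf hU (fun N => vf hU (J N) φ) ψ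

/-- The matrix of the brackets of the variables `u_N` for the operator `P`. -/
def kernel (P : DiffOp D U) (N M : MultiIndex D) : DiffFun D U := shift N (opCoeff P (M - N))

lemma shift_kernel (P : DiffOp D U) (K N M : MultiIndex D) :
    shift K (kernel P N M) = kernel P (N + K) (M + K) := by
  rw [kernel, kernel, shift_shift, add_comm N K, add_comm M K, add_sub_add_left_eq_sub]

/-- The matrix of brackets is translation invariant, so shifts are automorphisms of the bracket. -/
lemma shift_br_kernel (P : DiffOp D U) (K : MultiIndex D) (φ ψ : DiffFun D U) :
    shift K (br hU (kernel P) φ ψ) = br hU (kernel P) (shift K φ) (shift K ψ) := by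
  rw [br, shift_vf, br]
  congr 1
  funext N
  rw [shift_vf]
  congr 1
  funext M
  rw [shift_kernel, sub_add_cancel, sub_add_cancel]

/-- The factor $\mathcal S^K(\partial f/\partial u_M)$ is $\partial(\mathcal S^Kf)/\partial
u_{M+K}$; reindexing by $M+K$ removes λ from the bracket. -/
lemma lambdaBracket_eq_br (P : DiffOp D U) (f g : DiffFun D U) (K : MultiIndex D) :
    lambdaBracket hU P f g K = br hU (kernel P) (shift K f) g := by
  classical
  obtain ⟨s, hs⟩ := exists_finset_partialD_eq_zero hU g
  obtain ⟨t, ht⟩ := exists_finset_partialD_eq_zero hU f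
  have ht' : ∀ M ∉ t.map (addRightEmbedding K), partialD hU M (shift K f) = 0 := by
    intro N hN
    rw [partialD_shift', ht, map_zero]
    intro hN'
    exact hN (by simpa using ⟨_, hN', sub_add_cancel N K⟩)
  have hop : bracketOp hU P f g = ∑ N ∈ s, ∑ M ∈ t,
      mulOp (partialD hU N g) * shiftOp N * P * shiftOp (-M) * mulOp (partialD hU M f) := by
    have inner : ∀ N, ∑ᶠ (M : MultiIndex D),
        mulOp (partialD hU N g) * shiftOp N * P * shiftOp (-M) * mulOp (partialD hU M f) =
        ∑ M ∈ t,
          mulOp (partialD hU N g) * shiftOp N * P * shiftOp (-M) * mulOp (partialD hU M f) := by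
      intro N
      refine finsum_eq_sum_of_support_subset _ fun M hM => ?_
      by_contra h
      exact hM (by simp only [ht M h, mulOp_zero, mul_zero])
    rw [bracketOp]
    simp only [inner]
    refine finsum_eq_sum_of_support_subset _ fun N hN => ?_
    by_contra h
    exact hN (by simp only [hs N h, mulOp_zero, zero_mul, Finset.sum_const_zero])
  rw [lambdaBracket, hop, opCoeff_sum, br, vf_eq_sum hU _ hs]
  refine Finset.sum_congr rfl fun N _ => ?_
  rw [opCoeff_sum, vf_eq_sum hU _ ht', Finset.sum_map, Finset.mul_sum]
  refine Finset.sum_congr rfl fun M _ => ?_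
  rw [opCoeff_sandwich, addRightEmbedding_apply, partialD_shift, kernel,
    show M + K - N = K - N + M by abel]
  ring

/-- The Lie algebra axioms for the bracket `[·,·]` on `𝒜`. -/
def IsLieBracket (b : DiffFun D U → DiffFun D U → DiffFun D U) : Prop :=
  (∀ φ ψ, b ψ φ = -b φ ψ) ∧ ∀ φ ψ χ, b φ (b ψ χ) - b ψ (b φ χ) = b (b φ ψ) χ

/-- By shift equivariance each coefficient of an axiom is a Lie identity at shifted arguments;
conversely the coefficients with $K=R=0$ already give the Lie identities. -/
lemma isHamiltonian_iff (P : DiffOp D U) :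
    IsHamiltonian hU P ↔ IsLieBracket (br hU (kernel P)) := by
  simp only [IsHamiltonian, IsSkewsymmetric, SatisfiesJacobi, IsLieBracket, lambdaBracket_eq_br,
    smul_eq_shift, toAdd_ofAdd, shift_br_kernel, shift_shift, add_neg_cancel, shift_zero,
    add_sub_cancel]
  refine and_congr ⟨fun h φ ψ => ?_, fun h φ ψ K => h _ _⟩
    ⟨fun h φ ψ χ => ?_, fun h φ ψ χ K R => h _ _ _⟩
  · simpa only [shift_zero] using h φ ψ 0
  · simpa only [shift_zero] using h φ ψ χ 0 0

lemma br_gen_left (J : MultiIndex D → MultiIndex D → DiffFun D U) (M : MultiIndex D)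
    (ψ : DiffFun D U) : br hU J (gen U M) ψ = vf hU (fun N => J N M) ψ := by
  simp only [br, vf_gen]

lemma br_gen_right (J : MultiIndex D → MultiIndex D → DiffFun D U) (N : MultiIndex D)
    (φ : DiffFun D U) : br hU J φ (gen U N) = vf hU (J N) φ := by
  simp only [br, vf_gen]

lemma br_skew {J : MultiIndex D → MultiIndex D → DiffFun D U} (hJ : ∀ N M, J N M = -J M N)
    (φ ψ : DiffFun D U) : br hU J ψ φ = -br hU J φ ψ := by
  obtain ⟨s, h₁, h₂⟩ := exists_finset_partialD_eq_zero₂ hU φ ψ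
  simp only [br, vf_eq_sum hU _ h₁, vf_eq_sum hU _ h₂, Finset.mul_sum]
  rw [Finset.sum_comm, ← Finset.sum_neg_distrib]
  refine Finset.sum_congr rfl fun N _ => ?_
  rw [← Finset.sum_neg_distrib]
  refine Finset.sum_congr rfl fun M _ => ?_
  rw [hJ M N]
  ring

/-- The cyclic sum `[u_A,[u_B,u_C]] + [u_B,[u_C,u_A]] + [u_C,[u_A,u_B]]`. -/
def jacobiator (J : MultiIndex D → MultiIndex D → DiffFun D U) (A B C : MultiIndex D) :
    DiffFun D U :=
  vf hU (fun N => J N A) (J C B) + vf hU (fun N => J N B) (J A C)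
    + vf hU (fun N => J N C) (J B A)

/-- The defect of the Jacobi identity is a derivation in its last argument, being a commutator of
derivations minus a derivation; it is thus determined by its values on generators. -/
lemma jacobi_eq_vf (J : MultiIndex D → MultiIndex D → DiffFun D U) (φ ψ χ : DiffFun D U) :
    br hU J φ (br hU J ψ χ) - br hU J ψ (br hU J φ χ) - br hU J (br hU J φ ψ) χ =
      vf hU (fun N => br hU J φ (br hU J ψ (gen U N)) - br hU J ψ (br hU J φ (gen U N))
        - br hU J (br hU J φ ψ) (gen U N)) χ := by
  simp only [br_gen_right, vf_sub_left]
  congr 1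
  rw [← vf_sub_left]
  exact vf_commutator hU _ _ χ

theorem isLieBracket_br_iff (J : MultiIndex D → MultiIndex D → DiffFun D U) :
    IsLieBracket (br hU J) ↔
      (∀ N M, J N M = -J M N) ∧ ∀ A B C, jacobiator hU J A B C = 0 := by
  constructor
  · rintro ⟨h₁, h₂⟩
    have hJ : ∀ N M, J N M = -J M N := fun N M => by
      simpa only [br_gen_left, vf_gen] using h₁ (gen U N) (gen U M)
    refine ⟨hJ, fun A B C => ?_⟩
    have := h₂ (gen U A) (gen U B) (gen U C)
    rw [h₁ (gen U C) (br hU J (gen U A) (gen U B))] at this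
    simp only [br_gen_left, vf_gen] at this
    rw [jacobiator, hJ A C, vf_neg]
    linear_combination this
  · rintro ⟨hJ, h⟩
    have hsk := br_skew hU hJ
    have hneg : ∀ φ ψ, br hU J φ (-ψ) = -br hU J φ ψ := fun φ ψ => vf_neg hU _ ψ
    let T := fun φ ψ χ =>
      br hU J φ (br hU J ψ χ) - br hU J ψ (br hU J φ χ) - br hU J (br hU J φ ψ) χ
    -- Skewsymmetry makes the defect cyclically invariant. Each argument can then be rotated into
    -- the last slot, where the defect is a derivation, and replaced by generators.
    have hT : ∀ φ ψ χ, T φ ψ χ = T χ φ ψ := by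
      intro φ ψ χ
      simp only [T]
      rw [hsk χ (br hU J φ ψ), hsk χ φ, hsk χ ψ, hneg, hneg, hsk ψ (br hU J χ φ), hsk φ χ]
      rw [hneg]
      ring
    have hvf : ∀ φ ψ χ, T φ ψ χ = vf hU (fun N => T φ ψ (gen U N)) χ := jacobi_eq_vf hU J
    have h0 : ∀ A B C, T (gen U A) (gen U B) (gen U C) = 0 := by
      intro A B C
      rw [← h A B C]
      simp only [T, jacobiator]
      rw [hsk (gen U C) (br hU J (gen U A) (gen U B))]
      simp only [br_gen_left, vf_gen]
      rw [hJ A C, vf_neg]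
      ring
    have h1 : ∀ A B χ, T (gen U A) (gen U B) χ = 0 := by
      intro A B χ
      rw [hvf]
      simp only [h0, vf_zero_left]
    have h2 : ∀ A ψ χ, T (gen U A) ψ χ = 0 := by
      intro A ψ χ
      rw [hT, hvf]
      have : ∀ N, T χ (gen U A) (gen U N) = 0 := fun N => by rw [hT, hT, h1]
      simp only [this, vf_zero_left]
    refine ⟨fun φ ψ => hsk φ ψ, fun φ ψ χ => sub_eq_zero.1 ?_⟩
    change T φ ψ χ = 0
    rw [hvf]
    have : ∀ N, T φ ψ (gen U N) = 0 := fun N => by rw [hT, h2]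
    simp only [this, vf_zero_left]

end Bracket

/-! ### The combinatorial Jacobi identity for the line kernel -/

section LineKernel

variable {V R : Type*} [AddCommGroup V] [CommRing R]

open scoped Classical in
/-- The antisymmetric matrix with entries `x_N + x_{N+E} + b` at `(N, N + E)` and `x_{N+E}` at
`(N, N + 2E)`. -/
def lineKernel (x : V → R) (b : R) (E N M : V) : R :=
  if M = N + E then x N + x M + b
  else if M = N + E + E then x (N + E)
  else if N = M + E then -(x M + x N + b)
  else if N = M + E + E then -x (M + E)
  else 0

/-- `E` generates an infinite cyclic subgroup. -/
def IsNonTorsion (E : V) : Prop := ∀ n : ℤ, n • E = 0 → n = 0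

lemma isNonTorsion_one : IsNonTorsion (1 : ℤ) := fun n hn => by simpa using hn

/-- On a coset of $\mathbb ZE$ everything reduces to the integers with step 1. -/
lemma lineKernel_line {E : V} (hE : IsNonTorsion E) (x : V → R) (b : R) (C : V) (m n : ℤ) :
    lineKernel x b E (C + m • E) (C + n • E) = lineKernel (fun j : ℤ => x (C + j • E)) b 1 m n := by
  have key : ∀ m n : ℤ, C + n • E = C + m • E ↔ n = m := by
    intro m n
    rw [add_right_inj, ← sub_eq_zero, ← sub_smul]
    exact ⟨fun h => by have := hE _ h; omega, fun h => by simp [h]⟩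
  have step : ∀ m : ℤ, C + m • E + E = C + (m + 1) • E := fun m => by
    rw [add_smul, one_smul, add_assoc]
  simp only [lineKernel, step, key]

/-- The forward and backward cases could overlap only if $2E$, $3E$ or $4E$ vanished. -/
lemma lineKernel_antisymm {E : V} (hE : IsNonTorsion E) (x : V → R) (b : R) (N M : V) :
    lineKernel x b E N M = -lineKernel x b E M N := by
  have key : ∀ (n : ℤ) (A : V), n ≠ 0 → A ≠ A + n • E :=
    fun n A hn h => hn (hE n (by simpa using h.symm))
  have n2 : ∀ A : V, A ≠ A + E + E := fun A => by
    simpa [two_smul, add_assoc] using key 2 A two_ne_zero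
  have n3 : ∀ A : V, A ≠ A + E + E + E := fun A => by
    have := key 3 A three_ne_zero
    rwa [show (3 : ℤ) = 1 + 1 + 1 by norm_num, add_smul, add_smul, one_smul, ← add_assoc,
      ← add_assoc] at this
  have n4 : ∀ A : V, A ≠ A + E + E + E + E := fun A => by
    have := key 4 A four_ne_zero
    rwa [show (4 : ℤ) = 1 + 1 + 1 + 1 by norm_num, add_smul, add_smul, add_smul, one_smul,
      ← add_assoc, ← add_assoc, ← add_assoc] at this
  simp only [lineKernel]
  by_cases h1 : M = N + E
  · subst h1
    simp [n2 N, n3 N]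
  by_cases h2 : M = N + E + E
  · subst h2
    simp [n3 N, n4 N, h1]
  simp only [h1, h2, if_false]
  split_ifs <;> simp

lemma lineKernel_eq_zero_of_lt (x : ℤ → R) (b : R) {m n : ℤ} (h : m + 2 < n) :
    lineKernel x b 1 m n = 0 := by
  simp only [lineKernel]
  rw [if_neg (by omega), if_neg (by omega), if_neg (by omega), if_neg (by omega)]

lemma lineKernel_eq_zero_of_gt (x : ℤ → R) (b : R) {m n : ℤ} (h : n + 2 < m) :
    lineKernel x b 1 m n = 0 := by
  simp only [lineKernel]
  rw [if_neg (by omega), if_neg (by omega), if_neg (by omega), if_neg (by omega)]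

lemma lineKernel_eq_zero_of_forall {x : ℤ → R} {m n : ℤ} (hmn : n < m)
    (h : ∀ j, n ≤ j → j ≤ m → x j = 0) : lineKernel x 0 1 m n = 0 := by
  simp only [lineKernel]
  rw [if_neg (by omega), if_neg (by omega)]
  split_ifs with h1 h2
  · rw [h n le_rfl hmn.le, h m hmn.le le_rfl]
    simp
  · rw [h _ (by omega) (by omega), neg_zero]
  · rfl

/-- The kernel has range 2, so a gap larger than 2 kills all three terms; the four choices of gaps
in $\{1,2\}$ are polynomial identities. The outer kernels carry constant 0 because they come from
differentiating a kernel, which kills $b$. -/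
lemma lineKernel_jacobi_of_lt (x : ℤ → R) (b : R) {m n p : ℤ} (hmn : m < n) (hnp : n < p) :
    lineKernel (fun l => x l * lineKernel x b 1 l m) 0 1 p n
      + lineKernel (fun l => x l * lineKernel x b 1 l n) 0 1 m p
      + lineKernel (fun l => x l * lineKernel x b 1 l p) 0 1 n m = 0 := by
  by_cases h1 : m + 2 < n
  · rw [lineKernel_eq_zero_of_forall hnp, lineKernel_eq_zero_of_lt _ _ (by omega),
      lineKernel_eq_zero_of_gt _ _ h1, add_zero, add_zero]
    intro j hj _
    rw [lineKernel_eq_zero_of_gt _ _ (by omega), mul_zero]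
  by_cases h2 : n + 2 < p
  · rw [lineKernel_eq_zero_of_gt _ _ h2, lineKernel_eq_zero_of_lt _ _ (by omega),
      lineKernel_eq_zero_of_forall hmn, add_zero, add_zero]
    intro j _ hj
    rw [lineKernel_eq_zero_of_lt _ _ (by omega), mul_zero]
  have h3 : n = m + 1 ∨ n = m + 2 := by omega
  have h4 : p = n + 1 ∨ p = n + 2 := by omega
  rcases h3 with rfl | rfl <;> rcases h4 with rfl | rfl <;>
    simp [lineKernel, add_assoc] <;> ring

/-- Antisymmetry reduces every ordering to the increasing one; with a repeated index the terms
cancel. -/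
lemma lineKernel_jacobi_int (x : ℤ → R) (b : R) (m n p : ℤ) :
    lineKernel (fun l => x l * lineKernel x b 1 l m) 0 1 p n
      + lineKernel (fun l => x l * lineKernel x b 1 l n) 0 1 m p
      + lineKernel (fun l => x l * lineKernel x b 1 l p) 0 1 n m = 0 := by
  have anti : ∀ (y : ℤ → R) (m n : ℤ), lineKernel y 0 1 m n = -lineKernel y 0 1 n m :=
    fun y m n => lineKernel_antisymm isNonTorsion_one y 0 m n
  have diag : ∀ (y : ℤ → R) (m : ℤ), lineKernel y 0 1 m m = 0 := by
    intro y m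
    simp [lineKernel, add_assoc]
  rcases lt_trichotomy m n with h1 | rfl | h1
  · rcases lt_trichotomy n p with h2 | rfl | h2
    · exact lineKernel_jacobi_of_lt x b h1 h2
    · rw [diag, anti _ n m]
      ring
    · rcases lt_trichotomy m p with h3 | rfl | h3
      · have := lineKernel_jacobi_of_lt x b h3 h2
        rw [anti _ n p, anti _ m n, anti _ p m] at this
        linear_combination -this
      · rw [diag, anti _ n m]
        ring
      · linear_combination lineKernel_jacobi_of_lt x b h3 h1
  · rw [diag, anti _ m p]
    ring
  · rcases lt_trichotomy m p with h2 | rfl | h2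
    · have := lineKernel_jacobi_of_lt x b h1 h2
      rw [anti _ p m, anti _ n p, anti _ m n] at this
      linear_combination -this
    · rw [diag, anti _ n m]
      ring
    · rcases lt_trichotomy n p with h3 | rfl | h3
      · linear_combination lineKernel_jacobi_of_lt x b h3 h2
      · rw [diag, anti _ n m]
        ring
      · have := lineKernel_jacobi_of_lt x b h3 h1
        rw [anti _ p n, anti _ m p, anti _ n m]
        linear_combination -this

lemma lineKernel_eq_zero_of_not_mem {E C B : V} (h : ∀ n : ℤ, B ≠ C + n • E) (x : V → R) (b : R) :
    lineKernel x b E C B = 0 := by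
  simp only [lineKernel]
  rw [if_neg fun e => h 1 (by rw [e, one_smul]),
    if_neg fun e => h 2 (by rw [e, two_smul, add_assoc]),
    if_neg fun e => h (-1) (by rw [e, neg_one_smul, add_neg_cancel_right]),
    if_neg fun e => h (-2) (by rw [e, neg_smul, two_smul]; abel)]

lemma lineKernel_eq_zero_of_forall_line {E C : V} {x : V → R}
    (h : ∀ n : ℤ, x (C + n • E) = 0) (B : V) : lineKernel x 0 E C B = 0 := by
  by_cases hB : ∃ n : ℤ, B = C + n • E
  · obtain ⟨n, rfl⟩ := hB
    have h0 : x C = 0 := by simpa using h 0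
    have h1 : x (C + E) = 0 := by simpa using h 1
    have h2 : x (C + n • E + E) = 0 := by
      simpa [add_smul, add_assoc] using h (n + 1)
    simp [lineKernel, h, h0, h1, h2]
  · exact lineKernel_eq_zero_of_not_mem (by simpa using hB) x 0

/-- Unless the three sites lie on one coset of $\mathbb ZE$, every term vanishes; on a coset this is
the integer identity with $C$ as origin. -/
theorem lineKernel_jacobi {E : V} (hE : IsNonTorsion E) (x : V → R) (b : R) (A B C : V) :
    lineKernel (fun L => x L * lineKernel x b E L A) 0 E C B
      + lineKernel (fun L => x L * lineKernel x b E L B) 0 E A C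
      + lineKernel (fun L => x L * lineKernel x b E L C) 0 E B A = 0 := by
  have hz : ∀ A B C : V, ((∀ n : ℤ, B ≠ C + n • E) ∨ ∀ n : ℤ, A ≠ C + n • E) →
      lineKernel (fun L => x L * lineKernel x b E L A) 0 E C B = 0 := by
    rintro A B C (h | h)
    · exact lineKernel_eq_zero_of_not_mem h _ _
    · refine lineKernel_eq_zero_of_forall_line (fun n => ?_) B
      rw [lineKernel_eq_zero_of_not_mem, mul_zero]
      intro m hm
      exact h (n + m) (by rw [hm, add_smul, add_assoc])
  have symm : ∀ {A B : V}, (∀ n : ℤ, A ≠ B + n • E) → ∀ n : ℤ, B ≠ A + n • E := by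
    intro A B h n e
    exact h (-n) (by rw [e, neg_smul, add_neg_cancel_right])
  by_cases hB : ∃ n : ℤ, B = C + n • E
  · by_cases hA : ∃ m : ℤ, A = C + m • E
    · obtain ⟨n, rfl⟩ := hB
      obtain ⟨m, rfl⟩ := hA
      have := lineKernel_jacobi_int (fun j : ℤ => x (C + j • E)) b m n 0
      simp only [← lineKernel_line hE] at this
      have h0 : C + (0 : ℤ) • E = C := by simp
      have main : ∀ a p q : ℤ,
          lineKernel (fun L => x L * lineKernel x b E L (C + a • E)) 0 E (C + p • E) (C + q • E) =
          lineKernel (fun l : ℤ => x (C + l • E) * lineKernel x b E (C + l • E) (C + a • E)) 0 1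
            p q := fun a p q => lineKernel_line hE _ 0 C p q
      rw [← main, ← main, ← main] at this
      simpa only [h0] using this
    · push Not at hA
      rw [hz A B C (Or.inr hA), hz B C A (Or.inl (symm hA)), hz C A B, add_zero, add_zero]
      obtain ⟨n, rfl⟩ := hB
      refine Or.inl fun m hm => hA (n + m) ?_
      rw [hm, add_smul, add_assoc]
  · push Not at hB
    rw [hz A B C (Or.inl hB), hz C A B (Or.inr (symm hB)), hz B C A, add_zero, add_zero]
    by_contra hcon
    push Not at hcon
    obtain ⟨⟨n, hn⟩, m, hm⟩ := hcon
    exact hB (m - n) (by rw [hm, hn, sub_smul]; abel)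

end LineKernel

/-! ### Operators of one-dimensional form are Hamiltonian -/

section Operators

/-- The matrix `f_N f_M (…)` of the brackets `[u_M, u_N]` for an operator of one-dimensional
form. -/
def oneDimKernel {f G : ℂ → ℂ} (hf : AnalyticOnNhd ℂ f U) (hG : AnalyticOnNhd ℂ G U) (β : ℂ)
    (E N M : MultiIndex D) : DiffFun D U :=
  site hf N * site hf M * lineKernel (site hG) (algebraMap ℂ (DiffFun D U) (2 * β)) E N M

lemma opCoeff_sub (P Q : DiffOp D U) (L : MultiIndex D) :
    opCoeff (P - Q) L = opCoeff P L - opCoeff Q L := by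
  simp [opCoeff]

lemma kernel_add (P Q : DiffOp D U) (N M : MultiIndex D) :
    kernel (P + Q) N M = kernel P N M + kernel Q N M := by
  rw [kernel, opCoeff_add, map_add]
  rfl

lemma kernel_smul (η : ℂ) (P : DiffOp D U) (N M : MultiIndex D) :
    kernel (η • P) N M = algebraMap ℂ (DiffFun D U) η * kernel P N M := by
  have : opCoeff (η • P) (M - N) = algebraMap ℂ (DiffFun D U) η * opCoeff P (M - N) := by
    simp [opCoeff, Algebra.smul_def]
  rw [kernel, this, map_mul, shift_algebraMap]
  rfl

lemma isNonTorsion_single (i : Fin D) : IsNonTorsion (Pi.single i 1 : MultiIndex D) := by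
  intro n h
  simpa using congrFun h i

/-- The constant is $2\beta$ because β occurs once on each side of the shift. The offsets $\pm
E,\pm2E$ are distinct, so their coefficients do not mix. -/
lemma opCoeff_op (d : OneDimData U) (i : Fin D) (L : MultiIndex D) :
    opCoeff (d.op i) L =
      site d.analytic_f 0 * site d.analytic_f L *
        lineKernel (site d.isPower.1) (algebraMap ℂ (DiffFun D U) (2 * d.β))
          (Pi.single i 1) 0 L := by
  have hof : ∀ {f : ℂ → ℂ} (hf : AnalyticOnNhd ℂ f U), ofFun D hf = site hf 0 :=
    fun hf => (shift_zero _).symm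
  have hE : IsNonTorsion (Pi.single i 1 : MultiIndex D) := isNonTorsion_single i
  unfold OneDimData.op
  generalize (Pi.single i 1 : MultiIndex D) = E at *
  simp only [mulOp_eq, shiftOp, single_mul_single', mul_add, add_mul, opCoeff_add, opCoeff_sub,
    opCoeff_single, hof, map_add, map_mul, map_one, shift_site, shift_algebraMap, zero_add,
    add_zero, mul_one, one_mul]
  simp only [lineKernel]
  have key : ∀ n : ℤ, n ≠ 0 → n • E ≠ 0 := fun n hn h => hn (hE n h)
  have n1 : E ≠ 0 := by simpa using key 1 one_ne_zero
  have n2 : E + E ≠ 0 := by simpa [two_smul] using key 2 two_ne_zero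
  have n3 : E + E + E ≠ 0 := by
    have := key 3 three_ne_zero
    rwa [show (3 : ℤ) = 1 + 1 + 1 by norm_num, add_smul, add_smul, one_smul] at this
  have n4 : E + E + E + E ≠ 0 := by
    have := key 4 four_ne_zero
    rwa [show (4 : ℤ) = 1 + 1 + 1 + 1 by norm_num, add_smul, add_smul, add_smul, one_smul] at this
  have two : algebraMap ℂ (DiffFun D U) 2 = 2 := map_ofNat _ 2
  have c3 : ∀ L : MultiIndex D, -E = L ↔ 0 = L + E := fun L => by
    rw [eq_comm (a := (0 : MultiIndex D)), add_eq_zero_iff_neg_eq', eq_comm]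
  have c4 : ∀ L : MultiIndex D, -E + -E = L ↔ 0 = L + E + E := fun L => by
    rw [← neg_add, add_assoc, eq_comm (a := (0 : MultiIndex D)), add_eq_zero_iff_neg_eq', eq_comm]
  simp only [c3, c4]
  by_cases h1 : E = L
  · subst h1
    simp [n1, n2.symm, n3.symm, two]
    ring
  by_cases h2 : E + E = L
  · subst h2
    simp [n1, n3.symm, n4.symm]
    ring
  by_cases h3 : 0 = L + E
  · have h5 : -E = L := (c3 L).2 h3
    simp [h1, h2, n1.symm, Ne.symm h1, Ne.symm h2, h3.symm, h5, two]
    ring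
  by_cases h4 : 0 = L + E + E
  · have h5 : -E + -E = L := (c4 L).2 h4
    have h6 : L + E = -E := by rw [← h5, neg_add_cancel_right]
    have h7 : ¬L = E := fun h => h1 h.symm
    have h8 : ¬L = E + E := fun h => h2 h.symm
    rw [zero_add, if_neg h1, if_neg h1, if_neg h2, if_neg h3, if_neg h3, if_pos h4, if_neg h7,
      if_neg h8, if_neg h3, if_pos h4, h5, h6]
    ring
  simp [h1, h2, h3, h4, Ne.symm h1, Ne.symm h2]

lemma kernel_op (d : OneDimData U) (i : Fin D) (N M : MultiIndex D) :
    kernel (d.op i) N M =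
      oneDimKernel d.analytic_f d.isPower.1 d.β (Pi.single i 1) N M := by
  rw [kernel, opCoeff_op, map_mul, map_mul, shift_site, shift_site, add_zero, oneDimKernel,
    add_sub_cancel]
  congr 1
  simp only [lineKernel, zero_add, sub_eq_iff_eq_add', ← add_assoc]
  have c3 : ∀ E : MultiIndex D, 0 = M - N + E ↔ N = M + E := fun E => by
    rw [eq_comm, sub_add_eq_add_sub, sub_eq_zero, eq_comm]
  have c4 : ∀ E : MultiIndex D, 0 = M - N + E + E ↔ N = M + E + E := fun E => by
    rw [add_assoc, c3, add_assoc]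
  simp only [c3, c4]
  split_ifs <;>
    simp [shift_site, shift_algebraMap, ← add_assoc]

variable (hU : IsOpen U)

/-- By $fG'=\alpha G$ the vector field sends $G(u_L)$ to $\alpha f(u_A)\,G(u_L)k_L$. The kernel is
affine in these values, so it keeps its shape and loses its constant. -/
lemma vf_lineKernel {f G : ℂ → ℂ} (hf : AnalyticOnNhd ℂ f U) (hG : AnalyticOnNhd ℂ G U) {α : ℂ}
    (h : ∀ z ∈ U, f z * deriv G z = α * G z) (γ : ℂ) (E A B C : MultiIndex D)
    {k : MultiIndex D → DiffFun D U} :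
    vf hU (fun N => site hf N * site hf A * k N)
        (lineKernel (site hG) (algebraMap ℂ (DiffFun D U) γ) E C B) =
      algebraMap ℂ (DiffFun D U) α * site hf A *
        lineKernel (fun L => site hG L * k L) 0 E C B := by
  have hode : ∀ L, site hG.deriv L * site hf L = algebraMap ℂ (DiffFun D U) α * site hG L := by
    intro L
    refine Subtype.ext (funext fun x => ?_)
    change (site hG.deriv L).1 x * (site hf L).1 x = α * (site hG L).1 x
    rw [site_apply, site_apply, site_apply, mul_comm]
    exact h _ (x L).2
  have hs : ∀ L, vf hU (fun N => site hf N * site hf A * k N) (site hG L) =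
      algebraMap ℂ (DiffFun D U) α * site hf A * (site hG L * k L) := by
    intro L
    rw [vf_site]
    linear_combination site hf A * k L * hode L
  simp only [lineKernel]
  split_ifs
  · simp only [vf_add, vf_algebraMap, hs]
    ring
  · exact hs _
  · simp only [vf_neg, vf_add, vf_algebraMap, hs]
    ring
  · simp only [vf_neg, hs]
    ring
  · simp only [vf_zero, mul_zero]

lemma oneDimKernel_antisymm {f G : ℂ → ℂ} (hf : AnalyticOnNhd ℂ f U) (hG : AnalyticOnNhd ℂ G U)
    (β : ℂ) {E : MultiIndex D} (hE : IsNonTorsion E) (N M : MultiIndex D) :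
    oneDimKernel hf hG β E N M = -oneDimKernel hf hG β E M N := by
  rw [oneDimKernel, oneDimKernel, lineKernel_antisymm hE]
  ring

/-- In the cyclic sum the terms containing $f'$ cancel by antisymmetry, leaving $\alpha f_Af_Bf_C$
times `lineKernel_jacobi`. Only the linear equation for $G$ enters, so linear combinations of
solutions are allowed. -/
theorem isLieBracket_oneDimKernel {f G : ℂ → ℂ} (hf : AnalyticOnNhd ℂ f U)
    (hG : AnalyticOnNhd ℂ G U) {α : ℂ} (h : ∀ z ∈ U, f z * deriv G z = α * G z) (β : ℂ)
    {E : MultiIndex D} (hE : IsNonTorsion E) :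
    IsLieBracket (br hU (oneDimKernel hf hG β E)) := by
  rw [isLieBracket_br_iff]
  refine ⟨oneDimKernel_antisymm hf hG β hE, fun A B C => ?_⟩
  have key : ∀ A B C, vf hU (fun N => oneDimKernel hf hG β E N A) (oneDimKernel hf hG β E C B) =
      (site hf.deriv C * site hf A * site hf B * site hf C *
        lineKernel (site hG) (algebraMap ℂ (DiffFun D U) (2 * β)) E C A
      + site hf.deriv B * site hf A * site hf B * site hf C *
        lineKernel (site hG) (algebraMap ℂ (DiffFun D U) (2 * β)) E B A) *
        lineKernel (site hG) (algebraMap ℂ (DiffFun D U) (2 * β)) E C B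
      + algebraMap ℂ (DiffFun D U) α * (site hf A * site hf B * site hf C) *
        lineKernel (fun L => site hG L *
          lineKernel (site hG) (algebraMap ℂ (DiffFun D U) (2 * β)) E L A) 0 E C B := by
    intro A B C
    have := vf_lineKernel hU hf hG h (2 * β) E A B C
      (k := fun L => lineKernel (site hG) (algebraMap ℂ (DiffFun D U) (2 * β)) E L A)
    simp only [oneDimKernel]
    rw [vf_mul, vf_mul, vf_site, vf_site, this]
    ring
  rw [jacobiator, key A B C, key B C A, key C A B]
  have hJ := lineKernel_jacobi hE (site hG) (algebraMap ℂ (DiffFun D U) (2 * β)) A B C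
  rw [lineKernel_antisymm hE _ _ A C, lineKernel_antisymm hE _ _ B A,
    lineKernel_antisymm hE _ _ C B]
  linear_combination algebraMap ℂ (DiffFun D U) α * (site hf A * site hf B * site hf C) * hJ

end Operators

/-! ### Wronskians and the differential equation of the power branch -/

section Analysis

open Filter Topology

/-- The quotient $g/f$ is constant on a ball around $z_0$; the identity theorem extends the relation
to $U$, including zeros of $f$. -/
lemma eq_const_mul_of_wronskian_eq_zero (hUc : IsPreconnected U) {f g : ℂ → ℂ}
    (hf : AnalyticOnNhd ℂ f U) (hg : AnalyticOnNhd ℂ g U) {z₀ : ℂ} (hz₀ : z₀ ∈ U)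
    (hfz : f z₀ ≠ 0) (hW : ∀ᶠ z in 𝓝 z₀, deriv f z * g z - f z * deriv g z = 0) :
    ∀ z ∈ U, g z = g z₀ / f z₀ * f z := by
  have h1 : ∀ᶠ z in 𝓝 z₀, f z ≠ 0 := (hf z₀ hz₀).continuousAt.eventually_ne hfz
  have h2 := (hf z₀ hz₀).eventually_analyticAt
  have h3 := (hg z₀ hz₀).eventually_analyticAt
  obtain ⟨r, hr, hball⟩ := Metric.eventually_nhds_iff_ball.1 (((h1.and h2).and h3).and hW)
  have hd : ∀ z ∈ Metric.ball z₀ r, HasDerivAt (fun z => g z / f z) 0 z := by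
    intro z hz
    obtain ⟨⟨⟨a1, a2⟩, a3⟩, a4⟩ := hball z hz
    have := a3.differentiableAt.hasDerivAt.fun_div a2.differentiableAt.hasDerivAt a1
    convert! this using 1
    rw [eq_comm, div_eq_zero_iff]
    left
    linear_combination -a4
  have hc : ∀ z ∈ Metric.ball z₀ r, g z / f z = g z₀ / f z₀ := fun z hz =>
    Metric.isOpen_ball.is_const_of_deriv_eq_zero (Metric.isPreconnected_ball)
      (fun z hz => (hd z hz).differentiableAt.differentiableWithinAt)
      (fun z hz => (hd z hz).deriv) hz (Metric.mem_ball_self hr)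
  refine hg.eqOn_of_preconnected_of_eventuallyEq (analyticOnNhd_const.mul hf) hUc hz₀ ?_
  filter_upwards [Metric.ball_mem_nhds z₀ hr] with z hz
  rw [← hc z hz, div_mul_cancel₀ _ (hball z hz).1.1.1]

lemma not_countable_of_mem_nhds {s : Set ℂ} {z : ℂ} (hs : s ∈ 𝓝 z) : ¬ s.Countable := by
  intro h
  have h1 := h.dense_compl ℝ
  rw [← interior_eq_empty_iff_dense_compl] at h1
  exact Set.notMem_empty z (h1 ▸ mem_interior_iff_mem_nhds.2 hs)

namespace OneDimData

variable (d : OneDimData U)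

lemma exists_F_ne_zero : ∃ z ∈ U, d.F z ≠ 0 := by
  by_contra! h
  exact d.nonconstant_F ⟨0, h⟩

lemma f_ne_zero {z : ℂ} (hz : z ∈ U) (h : d.F z ≠ 0) : d.f z ≠ 0 := by
  intro h0
  have := d.ode z hz
  rw [h0, zero_mul] at this
  exact h this.symm

lemma Fpow_ne_zero {z : ℂ} (hz : z ∈ U) (h : d.F z ≠ 0) : d.Fpow z ≠ 0 := by
  obtain ⟨w, -, hw⟩ := d.isPower.2 z hz h
  rw [hw]
  exact Complex.exp_ne_zero _

/-- The logarithm defining the branch is chosen pointwise, so the branch is first compared with the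
analytic power $e^{\alpha l}$. -/
lemma Fpow_ode_of_ne_zero (hU : IsOpen U) {z₀ : ℂ} (hz₀ : z₀ ∈ U) (h₀ : d.F z₀ ≠ 0) :
    d.f z₀ * deriv d.Fpow z₀ = d.α * d.Fpow z₀ := by
  -- a local logarithm of `F`
  let l : ℂ → ℂ := fun z => Complex.log (d.F z / d.F z₀) + Complex.log (d.F z₀)
  have hslit : d.F z₀ / d.F z₀ ∈ Complex.slitPlane := by
    rw [div_self h₀]
    exact Complex.one_mem_slitPlane
  have hFd := (d.analytic_F z₀ hz₀).differentiableAt.hasDerivAt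
  have hl : HasDerivAt l (deriv d.F z₀ / d.F z₀) z₀ := by
    have := ((hFd.div_const (d.F z₀)).clog hslit).add_const (Complex.log (d.F z₀))
    convert! this using 1
    field_simp
  have hla : AnalyticAt ℂ l z₀ :=
    (((d.analytic_F z₀ hz₀).div_const).clog hslit).add analyticAt_const
  let q : ℂ → ℂ := fun z => d.Fpow z * Complex.exp (-(d.α * l z))
  have hqa : AnalyticAt ℂ q z₀ :=
    (d.isPower.1 z₀ hz₀).mul ((analyticAt_const.mul hla).neg.cexp)
  have hF : ∀ᶠ z in 𝓝 z₀, z ∈ U ∧ d.F z ≠ 0 := by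
    filter_upwards [hU.mem_nhds hz₀, (d.analytic_F z₀ hz₀).continuousAt.eventually_ne h₀]
      with z h1 h2 using ⟨h1, h2⟩
  have hq : ∀ᶠ z in 𝓝 z₀, q z ∈ Set.range fun n : ℤ =>
      Complex.exp (d.α * (n * (2 * Real.pi * Complex.I))) := by
    filter_upwards [hF] with z ⟨hz, hne⟩
    obtain ⟨w, hw, hG⟩ := d.isPower.2 z hz hne
    have hlz : Complex.exp (l z) = d.F z := by
      simp only [l]
      rw [Complex.exp_add, Complex.exp_log (div_ne_zero hne h₀), Complex.exp_log h₀,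
        div_mul_cancel₀ _ h₀]
    obtain ⟨n, hn⟩ := Complex.exp_eq_exp_iff_exists_int.1 (hw.trans hlz.symm)
    refine ⟨n, ?_⟩
    simp only [q]
    rw [hG, ← Complex.exp_add, hn]
    congr 1
    ring
  -- By the open mapping theorem, an analytic function with values in a countable set is locally
  -- constant.
  have hconst : ∀ᶠ z in 𝓝 z₀, q z = q z₀ := by
    refine hqa.eventually_constant_or_nhds_le_map_nhds.resolve_right fun h => ?_
    exact not_countable_of_mem_nhds (h hq) (Set.countable_range _)
  have hq0 : HasDerivAt q 0 z₀ :=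
    (hasDerivAt_const z₀ (q z₀)).congr_of_eventuallyEq hconst
  have hq1 := (d.isPower.1 z₀ hz₀).differentiableAt.hasDerivAt.fun_mul
    ((hl.const_mul d.α).fun_neg.cexp)
  have := hq0.unique hq1
  have he := Complex.exp_ne_zero (-(d.α * l z₀))
  have h2 : deriv d.Fpow z₀ - d.Fpow z₀ * (d.α * (deriv d.F z₀ / d.F z₀)) = 0 := by
    refine (mul_eq_zero.1 (?_ : _ * Complex.exp (-(d.α * l z₀)) = 0)).resolve_right he
    linear_combination -this
  have h3 := d.ode z₀ hz₀
  have h4 : d.f z₀ * (deriv d.F z₀ / d.F z₀) = 1 := by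
    rw [← mul_div_assoc, h3, div_self h₀]
  linear_combination d.f z₀ * h2 + d.Fpow z₀ * d.α * h4

/-- The identity theorem carries the equation to zeros of $F$, where the definition of a branch
imposes only analyticity. -/
theorem Fpow_ode (hU : IsOpen U) (hUc : IsConnected U) :
    ∀ z ∈ U, d.f z * deriv d.Fpow z = d.α * d.Fpow z := by
  obtain ⟨z₀, hz₀, h₀⟩ := d.exists_F_ne_zero
  refine (d.analytic_f.mul d.isPower.1.deriv).eqOn_of_preconnected_of_eventuallyEq
    (analyticOnNhd_const.mul d.isPower.1) hUc.isPreconnected hz₀ ?_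
  filter_upwards [hU.mem_nhds hz₀, (d.analytic_F z₀ hz₀).continuousAt.eventually_ne h₀]
    with z hz hne
  exact d.Fpow_ode_of_ne_zero hU hz hne

lemma exists_F_ne_zero₂ (hU : IsOpen U) (hUc : IsConnected U) (d₁ d₂ : OneDimData U) :
    ∃ z ∈ U, d₁.F z ≠ 0 ∧ d₂.F z ≠ 0 := by
  obtain ⟨z₀, hz₀, h₀⟩ := d₁.exists_F_ne_zero
  have h1 := (d₁.analytic_F z₀ hz₀).continuousAt.eventually_ne h₀
  by_contra! h
  refine d₂.nonconstant_F ⟨0, d₂.analytic_F.eqOn_of_preconnected_of_eventuallyEq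
    analyticOnNhd_const hUc.isPreconnected hz₀ ?_⟩
  filter_upwards [h1, hU.mem_nhds hz₀] with z hz hzU using h z hzU hz

end OneDimData

/-! ### Mixed Jacobi terms, and sufficiency of proportionality -/

/-- Evaluation of difference functions at a configuration. -/
def evalAt (x : Config D U) : DiffFun D U →+* ℂ :=
  (Pi.evalRingHom (fun _ => ℂ) x).comp (DiffFun D U).val.toRingHom

lemma evalAt_site {f : ℂ → ℂ} (hf : AnalyticOnNhd ℂ f U) (N : MultiIndex D) (x : Config D U) :
    evalAt x (site hf N) = f (x N) := site_apply hf N x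

lemma ext_evalAt {φ ψ : DiffFun D U} (h : ∀ x, evalAt x φ = evalAt x ψ) : φ = ψ :=
  Subtype.ext (funext h)

lemma evalAt_algebraMap (c : ℂ) (x : Config D U) :
    evalAt x (algebraMap ℂ (DiffFun D U) c) = c := rfl

variable (hU : IsOpen U)

/-- The terms of the Jacobi identity for `J + K` that mix the two brackets. -/
def mixedJacobiator (J K : MultiIndex D → MultiIndex D → DiffFun D U) (A B C : MultiIndex D) :
    DiffFun D U :=
  vf hU (fun N => J N A) (K C B) + vf hU (fun N => K N A) (J C B)
    + (vf hU (fun N => J N B) (K A C) + vf hU (fun N => K N B) (J A C))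
    + (vf hU (fun N => J N C) (K B A) + vf hU (fun N => K N C) (J B A))

lemma jacobiator_add (J K : MultiIndex D → MultiIndex D → DiffFun D U) (A B C : MultiIndex D) :
    jacobiator hU (fun N M => J N M + K N M) A B C =
      jacobiator hU J A B C + jacobiator hU K A B C + mixedJacobiator hU J K A B C := by
  simp only [jacobiator, mixedJacobiator, vf_add, vf_add_left]
  ring

lemma kernel_op_eq (d : OneDimData U) (i : Fin D) :
    kernel (d.op i) = oneDimKernel d.analytic_f d.isPower.1 d.β (Pi.single i 1) :=
  funext₂ fun N M => kernel_op d i N M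

/-- The Jacobi expression is quadratic in the matrix, so $\eta=1$ already isolates its polarisation.
-/
theorem mixedJacobiator_eq_zero {d₁ d₂ : OneDimData U} {i j : Fin D}
    (h : AreCompatible hU (d₁.op i) (d₂.op j)) (A B C : MultiIndex D) :
    mixedJacobiator hU (oneDimKernel d₁.analytic_f d₁.isPower.1 d₁.β (Pi.single i 1))
      (oneDimKernel d₂.analytic_f d₂.isPower.1 d₂.β (Pi.single j 1)) A B C = 0 := by
  obtain ⟨h₁, h₂, h₃⟩ := h
  have h₃ := h₃ 1
  rw [isHamiltonian_iff, isLieBracket_br_iff] at h₁ h₂ h₃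
  have e : kernel (d₁.op i + (1 : ℂ) • d₂.op j) =
      fun N M => kernel (d₁.op i) N M + kernel (d₂.op j) N M := by
    funext N M
    rw [kernel_add, one_smul]
  have := h₃.2 A B C
  rw [e, jacobiator_add, h₁.2, h₂.2, zero_add, zero_add] at this
  rwa [kernel_op_eq, kernel_op_eq] at this

theorem isHamiltonian_op_add_smul (hUc : IsConnected U) {d₁ d₂ : OneDimData U} (hα₂ : d₂.α ≠ 0)
    (i : Fin D) {κ : ℂ} (hf : ∀ z ∈ U, d₂.f z = κ * d₁.f z) (hα : d₂.α = κ * d₁.α) (η : ℂ) :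
    IsHamiltonian hU (d₁.op i + η • d₂.op i) := by
  have hκ : κ ≠ 0 := by
    rintro rfl
    exact hα₂ (by rw [hα, zero_mul])
  -- The factor $\kappa^2$ comes from $f_2(u_N)f_2(u_M)=\kappa^2f_1(u_N)f_1(u_M)$.
  have hK : AnalyticOnNhd ℂ (fun z => d₁.Fpow z + η * κ ^ 2 * d₂.Fpow z) U :=
    d₁.isPower.1.add (analyticOnNhd_const.mul d₂.isPower.1)
  have hode : ∀ z ∈ U, d₁.f z * deriv (fun z => d₁.Fpow z + η * κ ^ 2 * d₂.Fpow z) z =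
      d₁.α * (d₁.Fpow z + η * κ ^ 2 * d₂.Fpow z) := by
    intro z hz
    have h1 := d₁.Fpow_ode hU hUc z hz
    have h2 := d₂.Fpow_ode hU hUc z hz
    rw [hf z hz, hα] at h2
    have h3 : d₁.f z * deriv d₂.Fpow z = d₁.α * d₂.Fpow z :=
      mul_left_cancel₀ hκ (by linear_combination h2)
    rw [((d₁.isPower.1 z hz).differentiableAt.hasDerivAt.fun_add
      ((d₂.isPower.1 z hz).differentiableAt.hasDerivAt.const_mul (η * κ ^ 2))).deriv]
    linear_combination h1 + η * κ ^ 2 * h3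
  have hker : kernel (d₁.op i + η • d₂.op i) = oneDimKernel d₁.analytic_f hK
      (d₁.β + η * κ ^ 2 * d₂.β) (Pi.single i 1) := by
    funext N M
    rw [kernel_add, kernel_smul, kernel_op, kernel_op]
    refine ext_evalAt fun x => ?_
    simp only [oneDimKernel, lineKernel]
    split_ifs <;>
      simp only [map_add, map_mul, map_neg, map_zero, evalAt_site, evalAt_algebraMap,
        hf _ (x _).2] <;> ring
  rw [isHamiltonian_iff, hker]
  exact isLieBracket_oneDimKernel hU d₁.analytic_f hK hode _ (isNonTorsion_single i)

theorem areCompatible_of_proportional (hUc : IsConnected U) {d₁ d₂ : OneDimData U}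
    (hα₂ : d₂.α ≠ 0) (i : Fin D) {κ : ℂ} (hf : ∀ z ∈ U, d₂.f z = κ * d₁.f z)
    (hα : d₂.α = κ * d₁.α) : AreCompatible hU (d₁.op i) (d₂.op i) := by
  have key : ∀ d : OneDimData U, IsHamiltonian hU (d.op i) := by
    intro d
    rw [isHamiltonian_iff, kernel_op_eq]
    exact isLieBracket_oneDimKernel hU _ _ (d.Fpow_ode hU hUc) _ (isNonTorsion_single i)
  exact ⟨key d₁, key d₂, isHamiltonian_op_add_smul hU hUc hα₂ i hf hα⟩

end Analysis

/-! ### Necessity: evaluating the mixed Jacobi identity -/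

section Compatibility

open Filter Topology

variable (hU : IsOpen U)

lemma oneDimKernel_zsmul {f G : ℂ → ℂ} (hf : AnalyticOnNhd ℂ f U) (hG : AnalyticOnNhd ℂ G U)
    (β : ℂ) {E : MultiIndex D} (hE : IsNonTorsion E) (m n : ℤ) :
    oneDimKernel hf hG β E (m • E) (n • E) = site hf (m • E) * site hf (n • E) *
      lineKernel (fun j : ℤ => site hG (j • E)) (algebraMap ℂ (DiffFun D U) (2 * β)) 1 m n := by
  have := lineKernel_line hE (site hG) (algebraMap ℂ (DiffFun D U) (2 * β)) 0 m n
  simp only [zero_add] at this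
  rw [oneDimKernel, this]

/-- Only neighbours at distance 2 interact here, and only the middle variable $u_{2E}$ is
differentiated, through $f$ and $g$; hence the Wronskian factor. -/
lemma mixedJacobiator_zero_two_four {f g G H : ℂ → ℂ} (hf : AnalyticOnNhd ℂ f U)
    (hG : AnalyticOnNhd ℂ G U) (hg : AnalyticOnNhd ℂ g U) (hH : AnalyticOnNhd ℂ H U) (β γ : ℂ)
    {E : MultiIndex D} (hE : IsNonTorsion E) (x : Config D U) {z : ℤ → ℂ}
    (hz : ∀ n : ℤ, (x (n • E) : ℂ) = z n) :
    evalAt x (mixedJacobiator hU (oneDimKernel hf hG β E) (oneDimKernel hg hH γ E)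
      ((0 : ℤ) • E) ((2 : ℤ) • E) ((4 : ℤ) • E)) =
    (deriv f (z 2) * g (z 2) - f (z 2) * deriv g (z 2)) *
      (G (z 3) * H (z 1) * f (z 4) * g (z 0) - f (z 0) * g (z 4) * G (z 1) * H (z 3)) := by
  simp only [mixedJacobiator, oneDimKernel_zsmul _ _ _ hE, lineKernel, vf_mul, vf_neg, vf_site,
    vf_zero, Int.reduceAdd, Int.reduceEq, reduceIte, mul_zero, map_add, map_mul, map_neg, map_zero,
    evalAt_site, hz]
  ring

/-- Here $u_E$ and $u_{2E}$ are both differentiated, so $G'$ and $H'$ appear and the exponents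
become visible once the Wronskian vanishes. -/
lemma mixedJacobiator_zero_two_three {f g G H : ℂ → ℂ} (hf : AnalyticOnNhd ℂ f U)
    (hG : AnalyticOnNhd ℂ G U) (hg : AnalyticOnNhd ℂ g U) (hH : AnalyticOnNhd ℂ H U) (β γ : ℂ)
    {E : MultiIndex D} (hE : IsNonTorsion E) (x : Config D U) {z : ℤ → ℂ}
    (hz : ∀ n : ℤ, (x (n • E) : ℂ) = z n) :
    evalAt x (mixedJacobiator hU (oneDimKernel hf hG β E) (oneDimKernel hg hH γ E)
      ((0 : ℤ) • E) ((2 : ℤ) • E) ((3 : ℤ) • E)) =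
    -((deriv f (z 2) * g (z 2) - f (z 2) * deriv g (z 2)) *
      (f (z 0) * G (z 1) * g (z 3) * (H (z 2) + H (z 3) + 2 * γ)
        - g (z 0) * H (z 1) * f (z 3) * (G (z 2) + G (z 3) + 2 * β))
      - g (z 0) * H (z 1) * g (z 2) * f (z 3) * f (z 2) * deriv G (z 2)
      - f (z 0) * G (z 1) * f (z 2) * g (z 3) * g (z 2) * deriv H (z 2)
      + f (z 0) * f (z 2) * g (z 3) * deriv G (z 1) * g (z 1) * H (z 2)
      + g (z 0) * g (z 2) * f (z 3) * deriv H (z 1) * f (z 1) * G (z 2)) := by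
  simp only [mixedJacobiator, oneDimKernel_zsmul _ _ _ hE, lineKernel, vf_mul, vf_neg, vf_add,
    vf_site, vf_algebraMap, vf_zero, Int.reduceAdd, Int.reduceEq, reduceIte, mul_zero, map_add,
    map_mul, map_neg, map_zero, evalAt_site, evalAt_algebraMap, hz]
  ring

/-- The sites form a corner at 0: the first bracket sees only the pair $0,2E_i$, the second only
$0,E_j$, and the only derivative that contributes is the one in $u_0$. -/
lemma mixedJacobiator_transverse {f g G H : ℂ → ℂ} (hf : AnalyticOnNhd ℂ f U)
    (hG : AnalyticOnNhd ℂ G U) (hg : AnalyticOnNhd ℂ g U) (hH : AnalyticOnNhd ℂ H U) (β γ : ℂ)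
    {i j : Fin D} (hij : i ≠ j) (x : Config D U) :
    evalAt x (mixedJacobiator hU (oneDimKernel hf hG β (Pi.single i 1))
      (oneDimKernel hg hH γ (Pi.single j 1))
      (Pi.single i 1 + Pi.single i 1) 0 (Pi.single j 1)) =
    f (x (Pi.single i 1 + Pi.single i 1)) * G (x (Pi.single i 1)) * g (x (Pi.single j 1)) *
      ((deriv f (x 0) * g (x 0) - f (x 0) * deriv g (x 0)) *
        (H (x 0) + H (x (Pi.single j 1)) + 2 * γ) - f (x 0) * g (x 0) * deriv H (x 0)) := by
  have n1 : ∀ n : ℤ, (0 : MultiIndex D) ≠ Pi.single j 1 + n • Pi.single i 1 := fun n h => by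
    simpa [hij] using congrFun h j
  have n2 : ∀ n : ℤ, (Pi.single i 1 + Pi.single i 1 : MultiIndex D) ≠
      Pi.single j 1 + n • Pi.single i 1 := fun n h => by
    simpa [hij] using congrFun h j
  have n3 : ∀ n : ℤ, (Pi.single j 1 : MultiIndex D) ≠
      Pi.single i 1 + Pi.single i 1 + n • Pi.single i 1 := fun n h => by
    simpa [hij] using congrFun h j
  have n4 : ∀ n : ℤ, (Pi.single j 1 : MultiIndex D) ≠
      Pi.single i 1 + Pi.single i 1 + n • Pi.single j 1 := fun n h => by
    simpa [hij.symm] using congrFun h i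
  have n5 : ∀ n : ℤ, (Pi.single j 1 : MultiIndex D) ≠
      Pi.single i 1 + n • Pi.single j 1 := fun n h => by
    simpa [hij.symm] using congrFun h i
  have n6 : ∀ n : ℤ, (Pi.single i 1 + Pi.single i 1 : MultiIndex D) ≠
      0 + n • Pi.single j 1 := fun n h => by
    simpa [hij.symm] using congrFun h i
  have K : ∀ {f G : ℂ → ℂ} (hf : AnalyticOnNhd ℂ f U) (hG : AnalyticOnNhd ℂ G U) (β : ℂ)
      (i : Fin D), oneDimKernel hf hG β (Pi.single i 1) 0 (Pi.single i 1) =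
        site hf 0 * site hf (Pi.single i 1) * (site hG 0 + site hG (Pi.single i 1) +
          algebraMap ℂ (DiffFun D U) (2 * β)) := by
    intro f G hf hG β i
    simp [oneDimKernel, lineKernel]
  have K2 : ∀ {f G : ℂ → ℂ} (hf : AnalyticOnNhd ℂ f U) (hG : AnalyticOnNhd ℂ G U) (β : ℂ)
      (i : Fin D), oneDimKernel hf hG β (Pi.single i 1) 0 (Pi.single i 1 + Pi.single i 1) =
        site hf 0 * site hf (Pi.single i 1 + Pi.single i 1) * site hG (Pi.single i 1) := by
    intro f G hf hG β i
    simp [oneDimKernel, lineKernel]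
  have Z : ∀ {f G : ℂ → ℂ} (hf : AnalyticOnNhd ℂ f U) (hG : AnalyticOnNhd ℂ G U) (β : ℂ)
      {E N M : MultiIndex D}, (∀ n : ℤ, M ≠ N + n • E) → oneDimKernel hf hG β E N M = 0 := by
    intro f G hf hG β E N M h
    rw [oneDimKernel, lineKernel_eq_zero_of_not_mem h, mul_zero]
  simp only [mixedJacobiator, K2, Z _ _ _ n1, Z _ _ _ n2, Z _ _ _ n3, Z _ _ _ n6,
    oneDimKernel_antisymm hg hH γ (isNonTorsion_single j) (Pi.single j 1) 0, K, vf_mul, vf_neg,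
    vf_add, vf_site, vf_algebraMap, vf_zero, Z _ _ _ n4, Z _ _ _ n5, mul_zero, map_add, map_mul,
    map_neg, map_zero, evalAt_site, evalAt_algebraMap]
  ring

variable {d₁ d₂ : OneDimData U}

theorem proportional_of_areCompatible {i : Fin D} (hUc : IsConnected U)
    (h : AreCompatible hU (d₁.op i) (d₂.op i)) :
    ∃ κ : ℂ, ∀ z ∈ U, d₂.f z = κ * d₁.f z := by
  obtain ⟨z₀, hz₀, h1, h2⟩ := OneDimData.exists_F_ne_zero₂ hU hUc d₁ d₂
  have hf₁ := d₁.f_ne_zero hz₀ h1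
  have hG := d₁.Fpow_ne_zero hz₀ h1
  have hH := d₂.Fpow_ne_zero hz₀ h2
  refine ⟨d₂.f z₀ / d₁.f z₀, ?_⟩
  -- Both cases give proportionality. If the Wronskian is nonzero at $w$, set $u_{2E}=w$ and let
  -- $u_{4E}=c$ vary: the other factor must vanish.
  by_cases hW : ∀ z ∈ U, deriv d₁.f z * d₂.f z - d₁.f z * deriv d₂.f z = 0
  · refine eq_const_mul_of_wronskian_eq_zero hUc.isPreconnected d₁.analytic_f d₂.analytic_f hz₀
      hf₁ ?_
    filter_upwards [hU.mem_nhds hz₀] with z hz using hW z hz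
  · push Not at hW
    obtain ⟨w, hw, hW⟩ := hW
    intro c hc
    let z : ℤ → U := fun n => if n = 2 then ⟨w, hw⟩ else if n = 4 then ⟨c, hc⟩ else ⟨z₀, hz₀⟩
    have hJ := congrArg (evalAt fun N : MultiIndex D => z (N i))
      (mixedJacobiator_eq_zero hU h ((0 : ℤ) • Pi.single i 1) ((2 : ℤ) • Pi.single i 1)
        ((4 : ℤ) • Pi.single i 1))
    rw [mixedJacobiator_zero_two_four hU _ _ _ _ _ _ (isNonTorsion_single i) _
      (z := fun n => z n) (fun n => by simp), map_zero] at hJ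
    have z0 : (z 0 : ℂ) = z₀ := by simp [z]
    have z1 : (z 1 : ℂ) = z₀ := by simp [z]
    have z2 : (z 2 : ℂ) = w := by simp [z]
    have z3 : (z 3 : ℂ) = z₀ := by simp [z]
    have z4 : (z 4 : ℂ) = c := by simp [z]
    rw [z0, z1, z2, z3, z4] at hJ
    have h3 := (mul_eq_zero.1 hJ).resolve_left hW
    have h4 : d₁.f c * d₂.f z₀ - d₁.f z₀ * d₂.f c = 0 :=
      (mul_eq_zero.1 (by linear_combination h3 :
        (d₁.Fpow z₀ * d₂.Fpow z₀) * (d₁.f c * d₂.f z₀ - d₁.f z₀ * d₂.f c) = 0)).resolve_left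
          (mul_ne_zero hG hH)
    field_simp
    linear_combination -h4

theorem exponent_eq_of_areCompatible {i : Fin D} (hUc : IsConnected U)
    (h : AreCompatible hU (d₁.op i) (d₂.op i)) {κ : ℂ} (hκ : ∀ z ∈ U, d₂.f z = κ * d₁.f z) :
    d₂.α = κ * d₁.α := by
  obtain ⟨z₀, hz₀, h1, h2⟩ := OneDimData.exists_F_ne_zero₂ hU hUc d₁ d₂
  have hf₁ := d₁.f_ne_zero hz₀ h1
  have hf₂ := d₂.f_ne_zero hz₀ h2
  have hG := d₁.Fpow_ne_zero hz₀ h1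
  have hH := d₂.Fpow_ne_zero hz₀ h2
  have hκ0 : κ ≠ 0 := by
    rintro rfl
    exact hf₂ (by rw [hκ z₀ hz₀, zero_mul])
  have hd : deriv d₂.f z₀ = κ * deriv d₁.f z₀ := by
    have : d₂.f =ᶠ[𝓝 z₀] fun z => κ * d₁.f z := by
      filter_upwards [hU.mem_nhds hz₀] with z hz using hκ z hz
    rw [this.deriv_eq, deriv_const_mul _ (d₁.analytic_f z₀ hz₀).differentiableAt]
  by_contra hα
  -- If $\alpha_2\neq\kappa\alpha_1$, varying only $u_E=c$ forces the two powers to be proportional;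
  -- their differential equations then give $\alpha_2=\kappa\alpha_1$ after all.
  have key : ∀ c ∈ U, d₂.Fpow c = d₂.Fpow z₀ / d₁.Fpow z₀ * d₁.Fpow c := by
    intro c hc
    let z : ℤ → U := fun n => if n = 1 then ⟨c, hc⟩ else ⟨z₀, hz₀⟩
    have hJ := congrArg (evalAt fun N : MultiIndex D => z (N i))
      (mixedJacobiator_eq_zero hU h ((0 : ℤ) • Pi.single i 1) ((2 : ℤ) • Pi.single i 1)
        ((3 : ℤ) • Pi.single i 1))
    rw [mixedJacobiator_zero_two_three hU _ _ _ _ _ _ (isNonTorsion_single i) _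
      (z := fun n => z n) (fun n => by simp), map_zero] at hJ
    have z0 : (z 0 : ℂ) = z₀ := by simp [z]
    have z1 : (z 1 : ℂ) = c := by simp [z]
    have z2 : (z 2 : ℂ) = z₀ := by simp [z]
    have z3 : (z 3 : ℂ) = z₀ := by simp [z]
    rw [z0, z1, z2, z3] at hJ
    have o1 := d₁.Fpow_ode hU hUc z₀ hz₀
    have o2 := d₁.Fpow_ode hU hUc c hc
    have o3 := d₂.Fpow_ode hU hUc z₀ hz₀
    have o4 := d₂.Fpow_ode hU hUc c hc
    rw [hκ z₀ hz₀] at o3 hJ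
    rw [hκ c hc] at o4 hJ
    rw [hd] at hJ
    have h3 : (d₁.f z₀ ^ 3 * κ * (d₂.α - κ * d₁.α)) *
        (d₁.Fpow c * d₂.Fpow z₀ - d₂.Fpow c * d₁.Fpow z₀) = 0 := by
      linear_combination hJ
        - κ ^ 2 * d₁.f z₀ ^ 3 * d₂.Fpow c * o1 + κ ^ 2 * d₁.f z₀ ^ 3 * d₂.Fpow z₀ * o2
        - κ * d₁.f z₀ ^ 3 * d₁.Fpow c * o3 + κ * d₁.f z₀ ^ 3 * d₁.Fpow z₀ * o4
    have h4 := (mul_eq_zero.1 h3).resolve_left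
      (mul_ne_zero (mul_ne_zero (pow_ne_zero _ hf₁) hκ0) (sub_ne_zero.2 hα))
    field_simp
    linear_combination -h4
  have hd2 : deriv d₂.Fpow z₀ = d₂.Fpow z₀ / d₁.Fpow z₀ * deriv d₁.Fpow z₀ := by
    have : d₂.Fpow =ᶠ[𝓝 z₀] fun z => d₂.Fpow z₀ / d₁.Fpow z₀ * d₁.Fpow z := by
      filter_upwards [hU.mem_nhds hz₀] with z hz using key z hz
    rw [this.deriv_eq, deriv_const_mul _ (d₁.isPower.1 z₀ hz₀).differentiableAt]
  have o1 := d₁.Fpow_ode hU hUc z₀ hz₀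
  have o2 := d₂.Fpow_ode hU hUc z₀ hz₀
  rw [hκ z₀ hz₀, hd2] at o2
  field_simp at o2
  exact hα (mul_right_cancel₀ hG (by linear_combination κ * o1 - o2))

theorem direction_eq_of_areCompatible {i j : Fin D} (hUc : IsConnected U) (hα₂ : d₂.α ≠ 0)
    (h : AreCompatible hU (d₁.op i) (d₂.op j)) : i = j := by
  by_contra hij
  obtain ⟨z₀, hz₀, h1, h2⟩ := OneDimData.exists_F_ne_zero₂ hU hUc d₁ d₂
  have hf₁ := d₁.f_ne_zero hz₀ h1
  have hf₂ := d₂.f_ne_zero hz₀ h2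
  have hG := d₁.Fpow_ne_zero hz₀ h1
  have hH := d₂.Fpow_ne_zero hz₀ h2
  have o := d₂.Fpow_ode hU hUc z₀ hz₀
  -- The right-hand side does not depend on $c=u_{E_j}$. As $F_2^{\alpha_2}$ is not locally constant
  -- at $z_0$, the Wronskian there must vanish, which contradicts the nonzero right-hand side.
  have key : ∀ c ∈ U, d₂.f c ≠ 0 →
      (deriv d₁.f z₀ * d₂.f z₀ - d₁.f z₀ * deriv d₂.f z₀) *
        (d₂.Fpow z₀ + d₂.Fpow c + 2 * d₂.β) = d₂.α * (d₁.f z₀ * d₂.Fpow z₀) := by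
    intro c hc hfc
    let x : Config D U := fun N => if N = Pi.single j 1 then ⟨c, hc⟩ else ⟨z₀, hz₀⟩
    have hJ := congrArg (evalAt x)
      (mixedJacobiator_eq_zero hU h (Pi.single i 1 + Pi.single i 1) 0 (Pi.single j 1))
    rw [mixedJacobiator_transverse hU _ _ _ _ _ _ hij, map_zero] at hJ
    have n1 : (0 : MultiIndex D) ≠ Pi.single j 1 := fun h => by simpa using congrFun h j
    have n2 : (Pi.single i 1 : MultiIndex D) ≠ Pi.single j 1 := fun h => by
      simpa [hij] using congrFun h i
    have n3 : (Pi.single i 1 + Pi.single i 1 : MultiIndex D) ≠ Pi.single j 1 := fun h => by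
      simpa [hij] using congrFun h i
    have x0 : (x 0 : ℂ) = z₀ := by simp only [x, if_neg n1]
    have x1 : (x (Pi.single i 1) : ℂ) = z₀ := by simp only [x, if_neg n2]
    have x2 : (x (Pi.single i 1 + Pi.single i 1) : ℂ) = z₀ := by simp only [x, if_neg n3]
    have x3 : (x (Pi.single j 1) : ℂ) = c := by simp only [x, if_true]
    rw [x0, x1, x2, x3] at hJ
    have h3 := (mul_eq_zero.1 hJ).resolve_left (mul_ne_zero (mul_ne_zero hf₁ hG) hfc)
    linear_combination h3 + d₁.f z₀ * o
  have hH' : deriv d₂.Fpow z₀ ≠ 0 := by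
    intro h0
    rw [h0, mul_zero] at o
    exact mul_ne_zero hα₂ hH o.symm
  obtain ⟨c, hc, hfc, hne⟩ : ∃ c ∈ U, d₂.f c ≠ 0 ∧ d₂.Fpow c ≠ d₂.Fpow z₀ := by
    by_contra! hcon
    refine hH' ?_
    have : d₂.Fpow =ᶠ[𝓝 z₀] fun _ => d₂.Fpow z₀ := by
      filter_upwards [hU.mem_nhds hz₀, (d₂.analytic_f z₀ hz₀).continuousAt.eventually_ne hf₂]
        with z hz hfz using hcon z hz hfz
    rw [this.deriv_eq, deriv_const]
  have hW : deriv d₁.f z₀ * d₂.f z₀ - d₁.f z₀ * deriv d₂.f z₀ = 0 :=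
    (mul_eq_zero.1 (by linear_combination key c hc hfc - key z₀ hz₀ hf₂ :
      (deriv d₁.f z₀ * d₂.f z₀ - d₁.f z₀ * deriv d₂.f z₀) * (d₂.Fpow c - d₂.Fpow z₀) =
        0)).resolve_right (sub_ne_zero.2 hne)
  have h4 := key z₀ hz₀ hf₂
  rw [hW, zero_mul] at h4
  exact mul_ne_zero hα₂ (mul_ne_zero hf₁ hH) h4.symm

end Compatibility

end DiffAlg

end

theorem mainTheorem7 (U : Set ℂ) (hU : IsOpen U) (hUc : IsConnected U)
    (d₁ d₂ : DiffAlg.OneDimData U) (hα₁ : d₁.α ≠ 0) (hα₂ : d₂.α ≠ 0) (i j : Fin 2) :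
    DiffAlg.AreCompatible hU (d₁.op i) (d₂.op j) ↔
      i = j ∧ ∃ κ : ℂ, (∀ z ∈ U, d₂.f z = κ * d₁.f z) ∧ d₂.α = κ * d₁.α := by
  constructor
  · intro h
    obtain rfl := DiffAlg.direction_eq_of_areCompatible hU hUc hα₂ h
    obtain ⟨κ, hκ⟩ := DiffAlg.proportional_of_areCompatible hU hUc h
    exact ⟨rfl, κ, hκ, DiffAlg.exponent_eq_of_areCompatible hU hUc h hκ⟩
  · rintro ⟨rfl, κ, hf, hα⟩
    exact DiffAlg.areCompatible_of_proportional hU hUc hα₂ i hf hα
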